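/- **Setting.** Let $x_{k+1}=Ax_k+w_k$ in $\mathbb{R}^n$, $k\ge 0$, where $w_k\sim\mathcal N(0,Q)$, $Q\succeq 0$, and $x_0$ is square integrable. Active sensors $i=1,\dots,S$ ($S\ge1$) have preprocessing delays $\delta_i\in\{1,2,\dots\}$, communication delays $\delta_{c,i}\in\mathbb N$ and fusion delays $\delta_{f,i}\in\mathbb N$ (which may depend on $\delta_i$). Put $\bar\delta_i=\delta_i+\delta_{c,i}$ and $\delta_f=\sum_i\delta_{f,i}$, and label the sensors so that $\bar\delta_1\le\dots\le\bar\delta_S$. Sensor $i$ measures $z^{(i)}_k=C_ix_k+v^{(i)}_k$ with $v_k^{(i)}\sim\mathcal N(0,R_i)$, $R_i=R_i(\delta_i)\succ0$ (for instance $R_i=\frac{b_i}{\delta_i}I$, $b_i>0$), and its packet is received iff $\gamma^{(i)}_k=1$, where $\gamma_k^{(i)}\in\{0,1\}$ and $\Pr(\gamma_k^{(i)}=1)=\lambda_i\in[0,1]$. The variables $x_0$, all $w_k$, all $v^{(i)}_k$ and the arrival vectors $(\gamma^{(i)}_k)_i$, $k\ge0$, are mutually independent; $\gamma_k^{(i)}$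 and $\gamma_k^{(j)}$ are uncorrelated for $i\ne j$. At time $k$ only the received measurements $z^{(i)}_\ell$ with $0\le\ell\le k-\bar\delta_i-\delta_f$ may be used. A *constant-gain filter* has gains that do not depend on the arrival sequence: gains $K_i$, and $L_{d,i}$ for $d<\bar\delta_S$. Its estimate of $x_k$ is $\hat x_k=\hat x_{k|k-1}$, where $\hat x_{0|-1}$ is an arbitrary deterministic vector and, for $0\le t<k$, $$\hat x_{t+1|t}=A\Big(\hat x_{t|t-1}+\sum_{i:\,\bar\delta_i\le d}\gamma_t^{(i)}G_{d,i}\,(z_t^{(i)}-C_i\hat x_{t|t-1})\Big),\qquad d=k-\delta_f-t,$$ with $G_{d,i}=K_i$ if $d\ge\bar\delta_S$ and $G_{d,i}=L_{d,i}$ otherwise. Gains $(K_i)$ *have the steady state* $\Sigma$ if the mean squared error matrix of the one-step predictor $\hat x_{t+1|t}=A(\hat x_{t|t-1}+\sum_i\gamma_t^{(i)}K_i(z^{(i)}_t-C_i\hat x_{t|t-1}))$ that uses all sensors converges to $\Sigma$ for every deterministic initial estimate. Assume that some gains $(K_i)$ have a steady state (this is the assumption that the packet-loss probabilities are small enough).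 With $\Gamma_i=C_i^TR_i^{-1}C_i$ and $P\succ0$ define $$\mathcal T(P)=APA^T+Q,\quad \tilde\Gamma_d(P)=\sum_{i:\,\bar\delta_i\le d}\lambda_i\Big[\Gamma_i-(1-\lambda_i)\Gamma_i\big(P^{-1}+(1-\lambda_i)\Gamma_i\big)^{-1}\Gamma_i\Big],$$ $$\mathcal U_d(P)=\big(P^{-1}+\tilde\Gamma_d(P)\big)^{-1},\qquad \mathcal F_d=\mathcal T\circ\mathcal U_d,$$ and the multi-step iteration, for $a\ge b$, $\mathcal F^{a\to b}=\mathcal F_b\circ\mathcal F_{b+1}\circ\dots\circ\mathcal F_{a-1}$ ($a-b$ factors). The *constant-gain Kalman filter* built on $P$ has the gains $K_i=\kappa_{\bar\delta_S,i}(P)$ and $L_{d,i}=\kappa_{d,i}\big(\mathcal F^{\bar\delta_S\to d+1}(P)\big)$, where $\kappa_{d,i}(P)=\mathcal U_d(P)C_i^T\big((1-\lambda_i)C_iPC_i^T+R_i\big)^{-1}$. **Theorem.** If $(A,Q^{1/2})$ is controllable, then the algebraic Riccati equation with all active sensors, $P=\mathcal F_{\bar\delta_S}(P)$, has a positive definite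 solution. Whether or not $(A,Q^{1/2})$ is controllable, if $P_\infty\succ0$ is a solution, then it is the only positive definite one, the gains $(K_i)$ of the constant-gain Kalman filter built on $P_\infty$ have the steady state $P_\infty$, and the steady-state expected error covariance of that filter, with the expectation taken over the arrival sequence $\gamma$, exists and is, whatever the initial estimate, $$P_{\mathrm{steady}}=\lim_{k\to\infty}\mathbb E\big[\operatorname{Var}(x_k-\hat x_k\mid\gamma)\big]=\mathcal T^{\delta_{\mathrm{pred}}}\Big(\mathcal F^{\bar\delta_S\to\bar\delta_1}(P_\infty)\Big),\qquad \delta_{\mathrm{pred}}=\bar\delta_1-1+\delta_f ;$$ in particular the cost, the limit of the traces, is the trace of the right-hand side. Moreover this filter is optimal among constant-gain filters: if the gains $(K_i)$ of a constant-gain filter have a steady state and $\mathbb E[\operatorname{Var}(x_k-\hat x_k\mid\gamma)]$ converges to $\Sigma$ for that filter, then $\Sigma\succeq P_{\mathrm{steady}}$. -/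

import Mathlib

open MeasureTheory ProbabilityTheory Filter Topology Matrix

/-- The parameters of a processing network with active sensors `0, …, s` (so at least one sensor)
monitoring `x (k+1) = A x k + w k` in `ℝⁿ`.  Sensor `i` has output matrix `C i`, noise covariance
`R i d` when its preprocessing delay is `d` (for instance `(b i / d) • 1`), packets that are received
with probability `lam i`, and communication and fusion delays `comm i d`, `fus i d` that may depend on
the preprocessing delay `d`.  All delays are in time steps. -/
structure ProcessingNetwork (n s : ℕ) (m : Fin (s + 1) → ℕ) where
  A : Matrix (Fin n) (Fin n) ℝ
  Q : Matrix (Fin n) (Fin n) ℝ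
  C : ∀ i, Matrix (Fin (m i)) (Fin n) ℝ
  R : ∀ i, ℕ → Matrix (Fin (m i)) (Fin (m i)) ℝ
  lam : Fin (s + 1) → ℝ
  comm : Fin (s + 1) → ℕ → ℕ
  fus : Fin (s + 1) → ℕ → ℕ
  Q_posSemidef : Q.PosSemidef
  R_posDef : ∀ i d, 0 < d → (R i d).PosDef
  lam_mem : ∀ i, lam i ∈ Set.Icc (0 : ℝ) 1

/-- The independent sources of randomness: the initial state, the system noise at each time, the
noise of each sensor at each time, and the packet arrivals at each time. -/
inductive NoiseSource (s : ℕ) : Type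
  | initial : NoiseSource s
  | system (k : ℕ) : NoiseSource s
  | sensor (k : ℕ) (i : Fin (s + 1)) : NoiseSource s
  | arrival (k : ℕ) : NoiseSource s

/-- A constant-gain filter for the network.  Data that are `d` steps old (not counting the fusion
delay) are fused with gains that depend on neither the time nor the arrival sequence: with `steady`
if `d` is at least the largest sensor delay (all the sensors are available), with `transient d`
otherwise. -/
structure ConstantGains (n s : ℕ) (m : Fin (s + 1) → ℕ) where
  steady : ∀ i, Matrix (Fin n) (Fin (m i)) ℝ
  transient : ℕ → ∀ i, Matrix (Fin n) (Fin (m i)) ℝ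

namespace ProcessingNetwork

variable {n s : ℕ} {m : Fin (s + 1) → ℕ}

/-! ### Delays and Kalman filter operations -/

section Deterministic

variable (N : ProcessingNetwork n s m) (δ : Fin (s + 1) → ℕ)

/-- Preprocessing plus communication delay of sensor `i`. -/
def totalDelay (i : Fin (s + 1)) : ℕ := δ i + N.comm i (δ i)

/-- Total fusion delay. -/
def fusionDelay : ℕ := ∑ i, N.fus i (δ i)

/-- Sensors whose data are received within `d` steps. -/
def activeSensors (d : ℕ) : Finset (Fin (s + 1)) :=
  Finset.univ.filter fun i => N.totalDelay δ i ≤ d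

/-- `Γ i = (C i)ᵀ (R i)⁻¹ (C i)`. -/
noncomputable def sensorInfo (i : Fin (s + 1)) : Matrix (Fin n) (Fin n) ℝ :=
  (N.C i)ᵀ * (N.R i (δ i))⁻¹ * N.C i

/-- Information matrix of the data of delay `d`:
`∑ λᵢ [Γᵢ - Γᵢ (P⁻¹ / (1 - λᵢ) + Γᵢ)⁻¹ Γᵢ]`, written as
`∑ λᵢ [Γᵢ - (1 - λᵢ) Γᵢ (P⁻¹ + (1 - λᵢ) Γᵢ)⁻¹ Γᵢ]` so that it is `∑ Γᵢ` without packet loss. -/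
noncomputable def dataInfo (d : ℕ) (P : Matrix (Fin n) (Fin n) ℝ) : Matrix (Fin n) (Fin n) ℝ :=
  ∑ i ∈ N.activeSensors δ d,
    N.lam i • (N.sensorInfo δ i -
      (1 - N.lam i) •
        (N.sensorInfo δ i * (P⁻¹ + (1 - N.lam i) • N.sensorInfo δ i)⁻¹ * N.sensorInfo δ i))

/-- One-step prediction. -/
noncomputable def timeUpdate (P : Matrix (Fin n) (Fin n) ℝ) : Matrix (Fin n) (Fin n) ℝ :=
  N.A * P * N.Aᵀ + N.Q

/-- Measurement update with data of delay `d`. -/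
noncomputable def measUpdate (d : ℕ) (P : Matrix (Fin n) (Fin n) ℝ) : Matrix (Fin n) (Fin n) ℝ :=
  (P⁻¹ + N.dataInfo δ d P)⁻¹

/-- One-step Kalman filter iteration with data of delay `d`. -/
noncomputable def kfStep (d : ℕ) (P : Matrix (Fin n) (Fin n) ℝ) : Matrix (Fin n) (Fin n) ℝ :=
  N.timeUpdate (N.measUpdate δ d P)

/-- Multi-step Kalman filter iteration from delay `b + j - 1` down to delay `b` (`j` iterations,
the one with data of delay `b + j - 1` is performed first). -/
noncomputable def kfMultiStep (b : ℕ) :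
    ℕ → Matrix (Fin n) (Fin n) ℝ → Matrix (Fin n) (Fin n) ℝ
  | 0, P => P
  | j + 1, P => kfMultiStep b j (N.kfStep δ (b + j) P)

/-- The delay of the slowest sensor, when the sensors are sorted. -/
def maxDelay : ℕ := N.totalDelay δ (Fin.last s)

/-- The delay of the fastest sensor, when the sensors are sorted. -/
def minDelay : ℕ := N.totalDelay δ 0

/-- `P` is a positive definite solution of the ARE with all the sensors. -/
def IsARESolution (P : Matrix (Fin n) (Fin n) ℝ) : Prop :=
  P.PosDef ∧ P = N.kfStep δ (N.maxDelay δ) P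

/-- Length of the final multi-step prediction. -/
def predLength : ℕ := N.minDelay δ - 1 + N.fusionDelay δ

/-- Multi-step prediction applied to the multi-step Kalman filter iteration started at `P`. -/
noncomputable def predictedCov (P : Matrix (Fin n) (Fin n) ℝ) : Matrix (Fin n) (Fin n) ℝ :=
  N.timeUpdate^[N.predLength δ]
    (N.kfMultiStep δ (N.minDelay δ) (N.maxDelay δ - N.minDelay δ) P)

/-- Kalman gain of sensor `i` for the data of delay `d` when the predicted error covariance is `P`;
`(1 - λᵢ) Cᵢ P Cᵢᵀ + Rᵢ` is the noise covariance of sensor `i` inflated by packet loss. -/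
noncomputable def kalmanGain (d : ℕ) (P : Matrix (Fin n) (Fin n) ℝ) (i : Fin (s + 1)) :
    Matrix (Fin n) (Fin (m i)) ℝ :=
  N.measUpdate δ d P * (N.C i)ᵀ *
    ((1 - N.lam i) • (N.C i * P * (N.C i)ᵀ) + N.R i (δ i))⁻¹

/-- The gains of the constant-gain Kalman filter built on a predicted error covariance `P` with all
sensors: for data of delay `d` below the largest one, the predicted covariance has first gone through
the iterations with data of delays `maxDelay - 1, …, d + 1`. -/
noncomputable def kalmanGains (P : Matrix (Fin n) (Fin n) ℝ) : ConstantGains n s m where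
  steady := N.kalmanGain δ (N.maxDelay δ) P
  transient := fun d =>
    N.kalmanGain δ d (N.kfMultiStep δ (d + 1) (N.maxDelay δ - (d + 1)) P)

/-- Gain used at time `t` of the computation of the estimate of `x k`: only the data in the processed
dataset, those that sensor `i` acquired by time `k - totalDelay i - fusionDelay`, are used. -/
noncomputable def gainSchedule (G : ConstantGains n s m) (k t : ℕ) (i : Fin (s + 1)) :
    Matrix (Fin n) (Fin (m i)) ℝ :=
  if N.totalDelay δ i + N.fusionDelay δ + t ≤ k then
    if N.maxDelay δ ≤ k - N.fusionDelay δ - t then G.steady i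
    else G.transient (k - N.fusionDelay δ - t) i
  else 0

/-- Controllability of `(A, Q^{1/2})`, by the controllability Gramian. -/
def IsControllable : Prop :=
  (∑ j ∈ Finset.range n, N.A ^ j * N.Q * (N.Aᵀ) ^ j).PosDef

end Deterministic

/-! ### The stochastic model -/

/-- A realization of the network with preprocessing delays `δ` on a probability space: square
integrable initial state, Gaussian white system and sensor noises, and binary packet arrivals.  The
initial state, the noises and the arrivals at the different times are mutually independent; the
arrivals of different sensors at the same time are uncorrelated. -/
structure Realization (N : ProcessingNetwork n s m) (δ : Fin (s + 1) → ℕ)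
    {Ω : Type*} [MeasurableSpace Ω] (μ : Measure Ω) where
  x0 : Ω → Fin n → ℝ
  w : ℕ → Ω → Fin n → ℝ
  v : ℕ → ∀ i, Ω → Fin (m i) → ℝ
  γ : ℕ → Fin (s + 1) → Ω → ℝ
  x0_measurable : Measurable x0
  w_measurable : ∀ k, Measurable (w k)
  v_measurable : ∀ k i, Measurable (v k i)
  γ_measurable : ∀ k i, Measurable (γ k i)
  x0_memLp : MemLp x0 2 μ
  w_law : ∀ k, HasLaw (fun ω => WithLp.toLp 2 (w k ω)) (multivariateGaussian 0 N.Q) μ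
  v_law : ∀ k i, HasLaw (fun ω => WithLp.toLp 2 (v k i ω))
    (multivariateGaussian 0 (N.R i (δ i))) μ
  γ_binary : ∀ k i ω, γ k i ω = 0 ∨ γ k i ω = 1
  γ_prob : ∀ k i, μ.real {ω | γ k i ω = 1} = N.lam i
  γ_uncorrelated : ∀ k i j, i ≠ j → cov[γ k i, γ k j; μ] = 0
  indep : iIndep (fun a : NoiseSource s => match a with
    | .initial => MeasurableSpace.comap x0 inferInstance
    | .system k => MeasurableSpace.comap (w k) inferInstance
    | .sensor k i => MeasurableSpace.comap (v k i) inferInstance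
    | .arrival k => ⨆ i, MeasurableSpace.comap (γ k i) inferInstance) μ

namespace Realization

variable {N : ProcessingNetwork n s m} {δ : Fin (s + 1) → ℕ}
  {Ω : Type*} [MeasurableSpace Ω] {μ : Measure Ω} (X : Realization N δ μ)

/-- The state `x k`; time is counted from the initial time. -/
def state : ℕ → Ω → Fin n → ℝ
  | 0, ω => X.x0 ω
  | k + 1, ω => N.A *ᵥ state k ω + X.w k ω

/-- The measurement `z k i`. -/
def meas (k : ℕ) (i : Fin (s + 1)) (ω : Ω) : Fin (m i) → ℝ :=
  N.C i *ᵥ X.state k ω + X.v k i ω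

/-- The filter with gains `g t i` at time `t` and initial estimate `xh0`: one-step prediction of the
state at time `t`.  A measurement is used only if it is received. -/
def filterRun (g : ℕ → ∀ i, Matrix (Fin n) (Fin (m i)) ℝ) (xh0 : Fin n → ℝ) :
    ℕ → Ω → Fin n → ℝ
  | 0, _ => xh0
  | t + 1, ω => N.A *ᵥ (filterRun g xh0 t ω +
      ∑ i, X.γ t i ω • (g t i *ᵥ (X.meas t i ω - N.C i *ᵥ filterRun g xh0 t ω)))

/-- The estimate of `x k` by the constant-gain filter from the processed dataset at time `k`. -/
noncomputable def estimate (G : ConstantGains n s m) (xh0 : Fin n → ℝ) (k : ℕ) (ω : Ω) :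
    Fin n → ℝ :=
  X.filterRun (N.gainSchedule δ G k) xh0 k ω

/-- The σ-algebra generated by the whole arrival sequence. -/
@[reducible] def arrivals : MeasurableSpace Ω :=
  ⨆ k, ⨆ i, MeasurableSpace.comap (X.γ k i) inferInstance

/-- Expectation, over the arrival sequence, of the covariance matrix of a random vector `e` given the
arrival sequence. -/
noncomputable def expectedCov (e : Ω → Fin n → ℝ) : Matrix (Fin n) (Fin n) ℝ :=
  Matrix.of fun a b => ∫ ω, (μ[fun ω' =>
    (e ω' a - (μ[fun ω'' => e ω'' a | X.arrivals]) ω') *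
      (e ω' b - (μ[fun ω'' => e ω'' b | X.arrivals]) ω') | X.arrivals]) ω ∂μ

/-- `E[Var(x k - x̂ k)]` for the constant-gain filter with gains `G`. -/
noncomputable def errorCov (G : ConstantGains n s m) (xh0 : Fin n → ℝ) (k : ℕ) :
    Matrix (Fin n) (Fin n) ℝ :=
  X.expectedCov fun ω => X.state k ω - X.estimate G xh0 k ω

/-- Mean squared error matrix of the one-step predictor of `x t` that uses the constant gains `K` and
the data of all sensors acquired before time `t`. -/
noncomputable def predictorMSE (K : ∀ i, Matrix (Fin n) (Fin (m i)) ℝ) (xh0 : Fin n → ℝ) (t : ℕ) :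
    Matrix (Fin n) (Fin n) ℝ :=
  Matrix.of fun a b => ∫ ω,
    (X.state t ω a - X.filterRun (fun _ => K) xh0 t ω a) *
      (X.state t ω b - X.filterRun (fun _ => K) xh0 t ω b) ∂μ

/-- The all-sensor filter with constant gains `K` has the steady state `S`: whatever the initial
estimate, its mean squared error matrix converges to `S`. -/
def HasSteadyState (K : ∀ i, Matrix (Fin n) (Fin (m i)) ℝ) (S : Matrix (Fin n) (Fin n) ℝ) : Prop :=
  ∀ xh0 : Fin n → ℝ, Tendsto (fun t => X.predictorMSE K xh0 t) atTop (𝓝 S)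

end Realization

end ProcessingNetwork

/-! For fixed gains the prediction error obeys a linear recursion driven by independent noises and
random arrivals. Since the arrivals at time `t` are independent of the past and uncorrelated across
sensors, the second moment matrix of the error evolves by a deterministic affine map, `covStep`: a
positive linear part `propagate` plus a positive semidefinite constant. The random arrivals
contribute the terms with weight `λ (1 - λ)`, which inflate the sensor noise.

Completing the square (`josephUpdate_kalmanGain_add`) shows that the Riccati step `kfStep` is the
minimum of `covStep` over all gains, attained at the Kalman gain. Monotonicity in the covariance and
in the set of sensors follows by comparing with suboptimal gains.

A steady state reached from every initial estimate means that the powers of `propagate` kill every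
rank-one matrix, that is, mean square stability. The main point is that the Kalman gains of a
solution `P ≻ 0` inherit stability from any stable gains, without controllability. The trace of the
propagated `P` decreases; if its limit were positive, Cesàro means of the adjoint orbit of the
identity would give an invariant `Z ⪰ 0` with `tr (Z P) > 0`. The Riccati equation then forces `Z`
to annihilate `Q` and the effective gains, so that `P Z P` is a nonzero fixed point of the error
dynamics for every choice of gains, contradicting stability of the given ones.

Uniqueness follows because each solution is a subsolution for the stable recursion of the other. For
existence, the Riccati iteration started at a steady state of some gains decreases; controllability
makes its limit positive definite.

Conditionally on the arrivals, an error in the initial estimate is only a shift of the mean, so the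
expected conditional covariance follows the same recursion from the initial covariance. The schedule
at time `k` is a long run of steady steps, then steps with fewer and fewer sensors, then pure
prediction; the last two blocks have fixed length and are continuous, so the limit passes through
them. Optimality is the stepwise comparison of `kfStep` with `covStep`, started from `P ⪯ S`. -/

namespace ProcessingNetwork

open scoped MatrixOrder

/-! ### Loewner order on real matrices -/

section LoewnerOrder

variable {k l : Type*}

theorem conj_nonneg [Fintype k] [Finite l] {M : Matrix k k ℝ} (hM : 0 ≤ M) (B : Matrix l k ℝ) : 0 ≤ B * M * Bᵀ := by
  have := (Matrix.nonneg_iff_posSemidef.1 hM).mul_mul_conjTranspose_same B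
  rw [conjTranspose_eq_transpose_of_trivial] at this
  exact this.nonneg

theorem conj_mono [Fintype k] [Finite l] {M M' : Matrix k k ℝ} (h : M ≤ M') (B : Matrix l k ℝ) :
    B * M * Bᵀ ≤ B * M' * Bᵀ := by
  have := conj_nonneg (sub_nonneg.2 h) B
  rw [Matrix.mul_sub, Matrix.sub_mul] at this
  exact sub_nonneg.1 this

theorem matrix_smul_nonneg {M : Matrix k k ℝ} (hM : 0 ≤ M) {c : ℝ} (hc : 0 ≤ c) : 0 ≤ c • M :=
  ((Matrix.nonneg_iff_posSemidef.1 hM).smul hc).nonneg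

theorem matrix_smul_mono {M M' : Matrix k k ℝ} (h : M ≤ M') {c : ℝ} (hc : 0 ≤ c) :
    c • M ≤ c • M' := by
  have := matrix_smul_nonneg (sub_nonneg.2 h) hc
  rw [smul_sub] at this
  exact sub_nonneg.1 this

theorem posDef_of_le {M M' : Matrix k k ℝ} (hM : M.PosDef) (h : M ≤ M') : M'.PosDef := by
  have := hM.add_posSemidef (Matrix.le_iff.1 h)
  rwa [add_sub_cancel] at this

theorem transpose_eq_of_nonneg {M : Matrix k k ℝ} (hM : 0 ≤ M) : Mᵀ = M := by
  have := (Matrix.nonneg_iff_posSemidef.1 hM).isHermitian.eq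
  rwa [conjTranspose_eq_transpose_of_trivial] at this

theorem _root_.Matrix.PosDef.zero_le {M : Matrix k k ℝ} (hM : M.PosDef) : 0 ≤ M :=
  hM.posSemidef.nonneg

theorem mul_inv_of_posDef [Fintype k] [DecidableEq k] {M : Matrix k k ℝ} (hM : M.PosDef) : M * M⁻¹ = 1 :=
  Matrix.mul_nonsing_inv _ ((Matrix.isUnit_iff_isUnit_det _).1 hM.isUnit)

theorem inv_mul_of_posDef [Fintype k] [DecidableEq k] {M : Matrix k k ℝ} (hM : M.PosDef) : M⁻¹ * M = 1 :=
  Matrix.nonsing_inv_mul _ ((Matrix.isUnit_iff_isUnit_det _).1 hM.isUnit)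

end LoewnerOrder

/-! ### Covariance step with arbitrary gains -/

variable {n s : ℕ} {m : Fin (s + 1) → ℕ} (N : ProcessingNetwork n s m) (δ : Fin (s + 1) → ℕ)

theorem Q_nonneg : 0 ≤ N.Q := N.Q_posSemidef.nonneg

theorem lam_nonneg (i) : 0 ≤ N.lam i := (N.lam_mem i).1

theorem one_sub_lam_nonneg (i) : 0 ≤ 1 - N.lam i := sub_nonneg.2 (N.lam_mem i).2

/-- Noise covariance of sensor `i`, inflated by packet loss. -/
noncomputable def inflatedNoise (M : Matrix (Fin n) (Fin n) ℝ) (i : Fin (s + 1)) :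
    Matrix (Fin (m i)) (Fin (m i)) ℝ :=
  (1 - N.lam i) • (N.C i * M * (N.C i)ᵀ) + N.R i (δ i)

/-- Mean closed-loop matrix of the measurement update with gains `K` of the sensors in `I`. -/
noncomputable def meanResidual (I : Finset (Fin (s + 1))) (K : ∀ i, Matrix (Fin n) (Fin (m i)) ℝ) :
    Matrix (Fin n) (Fin n) ℝ :=
  1 - ∑ i ∈ I, N.lam i • (K i * N.C i)

/-- Error covariance after a measurement update with arbitrary gains `K` of the sensors in `I`
(the Joseph form). -/
noncomputable def josephUpdate (I : Finset (Fin (s + 1)))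
    (K : ∀ i, Matrix (Fin n) (Fin (m i)) ℝ) (M : Matrix (Fin n) (Fin n) ℝ) :
    Matrix (Fin n) (Fin n) ℝ :=
  N.meanResidual I K * M * (N.meanResidual I K)ᵀ +
    ∑ i ∈ I, N.lam i • (K i * N.inflatedNoise δ M i * (K i)ᵀ)

/-- One-step prediction after a measurement update with gains `K` of the sensors in `I`. -/
noncomputable def covStep (I : Finset (Fin (s + 1)))
    (K : ∀ i, Matrix (Fin n) (Fin (m i)) ℝ) (M : Matrix (Fin n) (Fin n) ℝ) :
    Matrix (Fin n) (Fin n) ℝ :=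
  N.timeUpdate (N.josephUpdate δ I K M)

/-- The linear part of `covStep`. -/
noncomputable def propagate (I : Finset (Fin (s + 1)))
    (K : ∀ i, Matrix (Fin n) (Fin (m i)) ℝ) :
    Matrix (Fin n) (Fin n) ℝ →ₗ[ℝ] Matrix (Fin n) (Fin n) ℝ where
  toFun M := N.A * (N.meanResidual I K * M * (N.meanResidual I K)ᵀ +
    ∑ i ∈ I, (N.lam i * (1 - N.lam i)) • ((K i * N.C i) * M * (K i * N.C i)ᵀ)) * N.Aᵀ
  map_add' M M' := by
    simp only [Matrix.mul_add, Matrix.add_mul, smul_add, Finset.sum_add_distrib]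
    abel
  map_smul' c M := by
    simp only [Matrix.mul_smul, Matrix.smul_mul, RingHom.id_apply, smul_add, Matrix.mul_add,
      Matrix.add_mul]
    simp only [smul_comm _ c, ← Finset.smul_sum, Matrix.mul_smul, Matrix.smul_mul]

/-- The constant part of `covStep`. -/
noncomputable def injectedNoise (I : Finset (Fin (s + 1)))
    (K : ∀ i, Matrix (Fin n) (Fin (m i)) ℝ) : Matrix (Fin n) (Fin n) ℝ :=
  N.A * (∑ i ∈ I, N.lam i • (K i * N.R i (δ i) * (K i)ᵀ)) * N.Aᵀ + N.Q

variable (I : Finset (Fin (s + 1))) (K : ∀ i, Matrix (Fin n) (Fin (m i)) ℝ)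

/-- The inflated noise splits into a part linear in `M`, which joins the closed loop with weight `λ
(1 - λ)`, and the constant sensor noise. Affinity is what lets differences of trajectories be
governed by powers of one positive linear map. -/
theorem covStep_eq (M : Matrix (Fin n) (Fin n) ℝ) :
    N.covStep δ I K M = N.propagate I K M + N.injectedNoise δ I K := by
  have h : ∑ i ∈ I, N.lam i • (K i * N.inflatedNoise δ M i * (K i)ᵀ) =
      ∑ i ∈ I, (N.lam i * (1 - N.lam i)) • ((K i * N.C i) * M * (K i * N.C i)ᵀ) +
        ∑ i ∈ I, N.lam i • (K i * N.R i (δ i) * (K i)ᵀ) := by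
    rw [← Finset.sum_add_distrib]
    refine Finset.sum_congr rfl fun i _ => ?_
    simp only [inflatedNoise, Matrix.mul_add, Matrix.add_mul, smul_add, Matrix.mul_smul,
      Matrix.smul_mul, smul_smul, Matrix.transpose_mul, Matrix.mul_assoc]
  simp only [covStep, timeUpdate, josephUpdate, h, propagate, injectedNoise, LinearMap.coe_mk,
    AddHom.coe_mk, Matrix.mul_add, Matrix.add_mul]
  abel

theorem propagate_apply (M : Matrix (Fin n) (Fin n) ℝ) :
    N.propagate I K M = N.A * (N.meanResidual I K * M * (N.meanResidual I K)ᵀ +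
      ∑ i ∈ I, (N.lam i * (1 - N.lam i)) • ((K i * N.C i) * M * (K i * N.C i)ᵀ)) * N.Aᵀ := rfl

theorem propagate_nonneg {M : Matrix (Fin n) (Fin n) ℝ} (hM : 0 ≤ M) : 0 ≤ N.propagate I K M := by
  rw [propagate_apply]
  exact conj_nonneg (add_nonneg (conj_nonneg hM _) (Finset.sum_nonneg fun i _ =>
    matrix_smul_nonneg (conj_nonneg hM _) (mul_nonneg (N.lam_nonneg i) (N.one_sub_lam_nonneg i)))) _

theorem propagate_mono : Monotone (N.propagate I K) := fun M M' h => by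
  have := N.propagate_nonneg I K (sub_nonneg.2 h)
  rw [map_sub] at this
  exact sub_nonneg.1 this

variable {δ} in
theorem R_posDef' (hδ : ∀ i, 0 < δ i) (i) : (N.R i (δ i)).PosDef := N.R_posDef i _ (hδ i)

variable {δ} in
theorem inflatedNoise_posDef (hδ : ∀ i, 0 < δ i) {M : Matrix (Fin n) (Fin n) ℝ} (hM : 0 ≤ M) (i) :
    (N.inflatedNoise δ M i).PosDef :=
  posDef_of_le (N.R_posDef' hδ i)
    (le_add_of_nonneg_left (matrix_smul_nonneg (conj_nonneg hM _) (N.one_sub_lam_nonneg i)))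

variable {δ} in
theorem injectedNoise_nonneg (hδ : ∀ i, 0 < δ i) : 0 ≤ N.injectedNoise δ I K :=
  add_nonneg (conj_nonneg (Finset.sum_nonneg fun i _ => matrix_smul_nonneg
    (conj_nonneg (N.R_posDef' hδ i).zero_le _) (N.lam_nonneg i)) _) N.Q_nonneg

theorem covStep_mono : Monotone (N.covStep δ I K) := fun M M' h => by
  rw [covStep_eq, covStep_eq]
  exact add_le_add_left (N.propagate_mono I K h) _

variable {δ} in
theorem covStep_nonneg (hδ : ∀ i, 0 < δ i) {M : Matrix (Fin n) (Fin n) ℝ} (hM : 0 ≤ M) :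
    0 ≤ N.covStep δ I K M := by
  rw [covStep_eq]
  exact add_nonneg (N.propagate_nonneg I K hM) (N.injectedNoise_nonneg I K hδ)

theorem timeUpdate_mono : Monotone N.timeUpdate := fun _ _ h =>
  add_le_add_left (conj_mono h _) _

variable {I K} in
theorem josephUpdate_congr {K' : ∀ i, Matrix (Fin n) (Fin (m i)) ℝ} (h : ∀ i ∈ I, K i = K' i)
    (M : Matrix (Fin n) (Fin n) ℝ) : N.josephUpdate δ I K M = N.josephUpdate δ I K' M := by
  have h1 : N.meanResidual I K = N.meanResidual I K' := by
    unfold meanResidual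
    rw [Finset.sum_congr rfl fun i hi => by rw [h i hi]]
  unfold josephUpdate
  rw [h1, Finset.sum_congr rfl fun i hi => by rw [h i hi]]

variable {I K} in
-- A sensor with zero gain contributes nothing. This lets different sensor sets be compared, and
-- unavailable sensors be treated as sensors with zero gain.
theorem josephUpdate_subset {J : Finset (Fin (s + 1))} (hIJ : I ⊆ J) (h : ∀ i ∈ J, i ∉ I → K i = 0)
    (M : Matrix (Fin n) (Fin n) ℝ) : N.josephUpdate δ J K M = N.josephUpdate δ I K M := by
  have h1 : N.meanResidual J K = N.meanResidual I K := by
    unfold meanResidual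
    rw [Finset.sum_subset hIJ fun i hi hi' => by rw [h i hi hi']; simp]
  unfold josephUpdate
  rw [h1, Finset.sum_subset hIJ fun i hi hi' => by rw [h i hi hi']; simp]

/-! ### Optimality of the Kalman gain -/

variable {δ} in
-- Woodbury identity for each sensor: packet loss amounts to replacing `R` by the inflated noise
-- covariance in the information matrix.
theorem dataInfo_eq (hδ : ∀ i, 0 < δ i) (d : ℕ) {M : Matrix (Fin n) (Fin n) ℝ} (hM : M.PosDef) :
    N.dataInfo δ d M =
      ∑ i ∈ N.activeSensors δ d, N.lam i • ((N.C i)ᵀ * (N.inflatedNoise δ M i)⁻¹ * N.C i) := by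
  refine Finset.sum_congr rfl fun i _ => ?_
  congr 1
  have hR := N.R_posDef' hδ i
  have hpos : (M⁻¹ + (1 - N.lam i) • N.sensorInfo δ i).PosDef := by
    refine hM.inv.add_posSemidef (Matrix.PosSemidef.smul ?_ (N.one_sub_lam_nonneg i))
    have := conj_nonneg hR.inv.zero_le (N.C i)ᵀ
    rw [Matrix.transpose_transpose] at this
    exact Matrix.nonneg_iff_posSemidef.1 this
  have hin : M⁻¹ + (N.C i)ᵀ * (N.R i (δ i))⁻¹ * ((1 - N.lam i) • N.C i) =
      M⁻¹ + (1 - N.lam i) • N.sensorInfo δ i := by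
    rw [Matrix.mul_smul]; rfl
  -- The factor `1 - λ` is attached to an outer factor and not to the inverted matrix `M`, so that
  -- the case `λ = 1` needs no separate treatment.
  have hW := Matrix.add_mul_mul_inv_eq_sub (A := N.R i (δ i)) (U := (1 - N.lam i) • N.C i)
    (C := M) (V := (N.C i)ᵀ) hR.isUnit hM.isUnit (by rw [hin]; exact hpos.isUnit)
  rw [hin] at hW
  have h1 : N.inflatedNoise δ M i = N.R i (δ i) + ((1 - N.lam i) • N.C i) * M * (N.C i)ᵀ := by
    rw [inflatedNoise, add_comm, Matrix.smul_mul, Matrix.smul_mul]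
  rw [h1, hW]
  simp only [sensorInfo, Matrix.mul_sub, Matrix.sub_mul, Matrix.mul_smul, Matrix.smul_mul,
    Matrix.mul_assoc]

variable {δ} in
theorem dataInfo_nonneg (hδ : ∀ i, 0 < δ i) (d : ℕ) {M : Matrix (Fin n) (Fin n) ℝ}
    (hM : M.PosDef) : 0 ≤ N.dataInfo δ d M := by
  rw [N.dataInfo_eq hδ d hM]
  refine Finset.sum_nonneg fun i _ => matrix_smul_nonneg ?_ (N.lam_nonneg i)
  have := conj_nonneg (N.inflatedNoise_posDef hδ hM.zero_le i).inv.zero_le (N.C i)ᵀ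
  rwa [Matrix.transpose_transpose] at this

variable {δ} in
theorem posDef_inv_add_dataInfo (hδ : ∀ i, 0 < δ i) (d : ℕ) {M : Matrix (Fin n) (Fin n) ℝ}
    (hM : M.PosDef) : (M⁻¹ + N.dataInfo δ d M).PosDef :=
  hM.inv.add_posSemidef (Matrix.nonneg_iff_posSemidef.1 (N.dataInfo_nonneg hδ d hM))

variable {δ} in
theorem measUpdate_posDef (hδ : ∀ i, 0 < δ i) (d : ℕ) {M : Matrix (Fin n) (Fin n) ℝ}
    (hM : M.PosDef) : (N.measUpdate δ d M).PosDef :=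
  (N.posDef_inv_add_dataInfo hδ d hM).inv

variable {δ} in
theorem kalmanGain_mul_inflatedNoise (hδ : ∀ i, 0 < δ i) (d : ℕ) {M : Matrix (Fin n) (Fin n) ℝ}
    (hM : M.PosDef) (i) :
    N.kalmanGain δ d M i * N.inflatedNoise δ M i = N.measUpdate δ d M * (N.C i)ᵀ := by
  change N.measUpdate δ d M * (N.C i)ᵀ * (N.inflatedNoise δ M i)⁻¹ * N.inflatedNoise δ M i = _
  rw [Matrix.mul_assoc, inv_mul_of_posDef (N.inflatedNoise_posDef hδ hM.zero_le i), Matrix.mul_one]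

variable {δ} in
theorem sum_kalmanGain_mul (hδ : ∀ i, 0 < δ i) (d : ℕ) {M : Matrix (Fin n) (Fin n) ℝ}
    (hM : M.PosDef) :
    ∑ i ∈ N.activeSensors δ d, N.lam i • (N.kalmanGain δ d M i * N.C i) =
      N.measUpdate δ d M * N.dataInfo δ d M := by
  rw [N.dataInfo_eq hδ d hM, Matrix.mul_sum]
  refine Finset.sum_congr rfl fun i _ => ?_
  rw [Matrix.mul_smul, ← Matrix.mul_assoc, ← Matrix.mul_assoc]
  rfl

variable {δ} in
-- With `U` the updated covariance and `D` the data information, the weighted gains sum to `U D`,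
-- and `U (M⁻¹ + D) = 1`.
theorem meanResidual_kalmanGain (hδ : ∀ i, 0 < δ i) (d : ℕ) {M : Matrix (Fin n) (Fin n) ℝ}
    (hM : M.PosDef) :
    N.meanResidual (N.activeSensors δ d) (N.kalmanGain δ d M) = N.measUpdate δ d M * M⁻¹ := by
  rw [meanResidual, N.sum_kalmanGain_mul hδ d hM, sub_eq_iff_eq_add, ← Matrix.mul_add]
  exact (inv_mul_of_posDef (N.posDef_inv_add_dataInfo hδ d hM)).symm

variable {δ} in
theorem meanResidual_kalmanGain_mul (hδ : ∀ i, 0 < δ i) (d : ℕ) {M : Matrix (Fin n) (Fin n) ℝ}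
    (hM : M.PosDef) :
    N.meanResidual (N.activeSensors δ d) (N.kalmanGain δ d M) * M = N.measUpdate δ d M := by
  rw [N.meanResidual_kalmanGain hδ d hM, Matrix.mul_assoc, inv_mul_of_posDef hM, Matrix.mul_one]

variable {δ} in
/-- Completion of squares in the measurement update. -/
theorem josephUpdate_kalmanGain_add (hδ : ∀ i, 0 < δ i) (d : ℕ) {M : Matrix (Fin n) (Fin n) ℝ}
    (hM : M.PosDef) (D : ∀ i, Matrix (Fin n) (Fin (m i)) ℝ) :
    N.josephUpdate δ (N.activeSensors δ d) (N.kalmanGain δ d M + D) M =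
      N.measUpdate δ d M +
        (∑ i ∈ N.activeSensors δ d, N.lam i • (D i * N.C i)) * M *
          (∑ i ∈ N.activeSensors δ d, N.lam i • (D i * N.C i))ᵀ +
        ∑ i ∈ N.activeSensors δ d, N.lam i • (D i * N.inflatedNoise δ M i * (D i)ᵀ) := by
  set I := N.activeSensors δ d
  set κ := N.kalmanGain δ d M with hκ
  set U := N.measUpdate δ d M with hUdef
  set E := ∑ i ∈ I, N.lam i • (D i * N.C i) with hE
  set X := N.meanResidual I κ with hX
  have hU : Uᵀ = U := transpose_eq_of_nonneg (N.measUpdate_posDef hδ d hM).zero_le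
  have hMT : Mᵀ = M := transpose_eq_of_nonneg hM.zero_le
  have hXM : X * M = U := N.meanResidual_kalmanGain_mul hδ d hM
  have hMX : M * Xᵀ = U := by rw [← hU, ← hXM, Matrix.transpose_mul, hMT]
  have hS : ∀ i, κ i * N.inflatedNoise δ M i = U * (N.C i)ᵀ :=
    fun i => N.kalmanGain_mul_inflatedNoise hδ d hM i
  have hST : ∀ i, N.inflatedNoise δ M i * (κ i)ᵀ = N.C i * U := fun i => by
    have := congrArg Matrix.transpose (hS i)
    rwa [Matrix.transpose_mul, Matrix.transpose_mul, hU, Matrix.transpose_transpose,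
      transpose_eq_of_nonneg (N.inflatedNoise_posDef hδ hM.zero_le i).zero_le] at this
  have hres : N.meanResidual I (κ + D) = X - E := by
    simp only [hX, meanResidual, hE, Pi.add_apply, Matrix.add_mul, smul_add,
      Finset.sum_add_distrib]
    abel
  have hone : X + ∑ i ∈ I, N.lam i • (κ i * N.C i) = 1 := by rw [hX, meanResidual]; abel
  -- The terms `U Eᵀ` and `E U`, linear in the perturbation `D`, will cancel against `X M Eᵀ` and `E
  -- M Xᵀ`, since `X M = U`. This is the first-order optimality of the Kalman gain.
  have hsum : ∑ i ∈ I, N.lam i • ((κ + D) i * N.inflatedNoise δ M i * ((κ + D) i)ᵀ) =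
      (∑ i ∈ I, N.lam i • (κ i * N.C i)) * U + U * Eᵀ + E * U +
        ∑ i ∈ I, N.lam i • (D i * N.inflatedNoise δ M i * (D i)ᵀ) := by
    rw [hE, Matrix.transpose_sum, Matrix.sum_mul, Matrix.mul_sum, Matrix.sum_mul,
      ← Finset.sum_add_distrib, ← Finset.sum_add_distrib, ← Finset.sum_add_distrib]
    refine Finset.sum_congr rfl fun i _ => ?_
    simp only [Pi.add_apply, Matrix.transpose_add, Matrix.add_mul, Matrix.mul_add, hS, smul_add,
      Matrix.transpose_smul, Matrix.transpose_mul, Matrix.smul_mul, Matrix.mul_smul]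
    rw [Matrix.mul_assoc (D i) _ (κ i)ᵀ, hST, ← hS, Matrix.mul_assoc (κ i) _ (κ i)ᵀ, hST]
    simp only [hS, Matrix.mul_assoc]
    abel
  rw [josephUpdate, hres, hsum, Matrix.transpose_sub, Matrix.mul_sub, Matrix.sub_mul,
    Matrix.sub_mul, hXM, Matrix.mul_assoc E M Xᵀ, hMX]
  have h2 : U * Xᵀ + (∑ i ∈ I, N.lam i • (κ i * N.C i)) * U = U := by
    have : U * Xᵀ = X * U := by
      calc U * Xᵀ = X * (M * Xᵀ) := by rw [← Matrix.mul_assoc, hXM]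
        _ = X * U := by rw [hMX]
    rw [this, ← Matrix.add_mul, hone, Matrix.one_mul]
  calc _ = (U * Xᵀ + (∑ i ∈ I, N.lam i • (κ i * N.C i)) * U) + E * M * Eᵀ +
        ∑ i ∈ I, N.lam i • (D i * N.inflatedNoise δ M i * (D i)ᵀ) := by
        simp only [Matrix.sub_mul]; abel
    _ = _ := by rw [h2]

variable {δ} in
theorem josephUpdate_kalmanGain (hδ : ∀ i, 0 < δ i) (d : ℕ) {M : Matrix (Fin n) (Fin n) ℝ}
    (hM : M.PosDef) :
    N.josephUpdate δ (N.activeSensors δ d) (N.kalmanGain δ d M) M = N.measUpdate δ d M := by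
  simpa using N.josephUpdate_kalmanGain_add hδ d hM 0

variable {δ} in
theorem measUpdate_le_josephUpdate (hδ : ∀ i, 0 < δ i) (d : ℕ) {M : Matrix (Fin n) (Fin n) ℝ}
    (hM : M.PosDef) :
    N.measUpdate δ d M ≤ N.josephUpdate δ (N.activeSensors δ d) K M := by
  have h := N.josephUpdate_kalmanGain_add hδ d hM (K - N.kalmanGain δ d M)
  rw [add_sub_cancel] at h
  rw [h, add_assoc]
  exact le_add_of_nonneg_right (add_nonneg (conj_nonneg hM.zero_le _) (Finset.sum_nonneg fun i _ =>
    matrix_smul_nonneg (conj_nonneg (N.inflatedNoise_posDef hδ hM.zero_le i).zero_le _)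
      (N.lam_nonneg i)))

variable {δ} in
theorem covStep_kalmanGain (hδ : ∀ i, 0 < δ i) (d : ℕ) {M : Matrix (Fin n) (Fin n) ℝ}
    (hM : M.PosDef) :
    N.covStep δ (N.activeSensors δ d) (N.kalmanGain δ d M) M = N.kfStep δ d M := by
  rw [covStep, N.josephUpdate_kalmanGain hδ d hM, kfStep]

variable {δ} in
theorem kfStep_le_covStep (hδ : ∀ i, 0 < δ i) (d : ℕ) {M : Matrix (Fin n) (Fin n) ℝ}
    (hM : M.PosDef) : N.kfStep δ d M ≤ N.covStep δ (N.activeSensors δ d) K M :=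
  N.timeUpdate_mono (N.measUpdate_le_josephUpdate K hδ d hM)

theorem josephUpdate_mono {M M' : Matrix (Fin n) (Fin n) ℝ} (h : M ≤ M') :
    N.josephUpdate δ I K M ≤ N.josephUpdate δ I K M' :=
  add_le_add (conj_mono h _) (Finset.sum_le_sum fun i _ => matrix_smul_mono (conj_mono
    (add_le_add_left (matrix_smul_mono (conj_mono h _) (N.one_sub_lam_nonneg i)) _) _)
      (N.lam_nonneg i))

variable {δ} in
-- The optimal gains for `M'` are suboptimal for `M`, and for frozen gains the Joseph form is
-- monotone.
theorem measUpdate_mono (hδ : ∀ i, 0 < δ i) (d : ℕ) {M M' : Matrix (Fin n) (Fin n) ℝ}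
    (hM : M.PosDef) (h : M ≤ M') : N.measUpdate δ d M ≤ N.measUpdate δ d M' := by
  rw [← N.josephUpdate_kalmanGain hδ d (posDef_of_le hM h)]
  exact (N.measUpdate_le_josephUpdate _ hδ d hM).trans (N.josephUpdate_mono δ _ _ h)

variable {δ} in
-- The gains that are optimal with few sensors, extended by zero, are admissible with more sensors.
theorem measUpdate_anti (hδ : ∀ i, 0 < δ i) {d d' : ℕ} (hd : d ≤ d')
    {M : Matrix (Fin n) (Fin n) ℝ} (hM : M.PosDef) :
    N.measUpdate δ d' M ≤ N.measUpdate δ d M := by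
  rw [← N.josephUpdate_kalmanGain hδ d hM]
  refine (N.measUpdate_le_josephUpdate
    (fun i => if i ∈ N.activeSensors δ d then N.kalmanGain δ d M i else 0) hδ d' hM).trans_eq ?_
  rw [N.josephUpdate_subset δ (I := N.activeSensors δ d)]
  · exact N.josephUpdate_congr δ (fun i hi => by simp [hi]) M
  · intro i
    simp only [activeSensors, Finset.mem_filter, Finset.mem_univ, true_and]
    omega
  · intro i _ hi
    simp [hi]

variable {δ} in
theorem kfStep_mono (hδ : ∀ i, 0 < δ i) (d : ℕ) {M M' : Matrix (Fin n) (Fin n) ℝ}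
    (hM : M.PosDef) (h : M ≤ M') : N.kfStep δ d M ≤ N.kfStep δ d M' :=
  N.timeUpdate_mono (N.measUpdate_mono hδ d hM h)

variable {δ} in
theorem kfStep_anti (hδ : ∀ i, 0 < δ i) {d d' : ℕ} (hd : d ≤ d')
    {M : Matrix (Fin n) (Fin n) ℝ} (hM : M.PosDef) :
    N.kfStep δ d' M ≤ N.kfStep δ d M :=
  N.timeUpdate_mono (N.measUpdate_anti hδ hd hM)

end ProcessingNetwork

namespace ProcessingNetwork

open scoped MatrixOrder

/-! ### Positive semidefinite matrices: traces, limits and domination -/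

section PositiveMatrices

variable {k l : Type*} [Fintype k] [Fintype l]

theorem exists_eq_transpose_mul_self {M : Matrix k k ℝ} (hM : 0 ≤ M) :
    ∃ B : Matrix k k ℝ, M = Bᵀ * B := by
  classical
  obtain ⟨B, hB⟩ := CStarAlgebra.nonneg_iff_eq_star_mul_self.mp hM
  exact ⟨B, by rw [hB, star_eq_conjTranspose, conjTranspose_eq_transpose_of_trivial]⟩

theorem transpose_mul_self_eq_sum {p : Type*} (B : Matrix k p ℝ) :
    Bᵀ * B = ∑ a, vecMulVec (B a) (B a) := by
  ext i j
  simp [Matrix.mul_apply, Matrix.sum_apply, vecMulVec_apply]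

theorem nonneg_iff_dotProduct {M : Matrix k k ℝ} :
    0 ≤ M ↔ Mᵀ = M ∧ ∀ x, 0 ≤ x ⬝ᵥ M *ᵥ x := by
  rw [Matrix.nonneg_iff_posSemidef, Matrix.posSemidef_iff_dotProduct_mulVec, Matrix.IsHermitian,
    conjTranspose_eq_transpose_of_trivial]
  simp

theorem vecMulVec_nonneg (h : k → ℝ) : 0 ≤ vecMulVec h h := by
  have := Matrix.posSemidef_vecMulVec_self_star h
  rw [star_trivial] at this
  exact this.nonneg

/-- Writing `M` as a Gram matrix, each entry is an inner product of two columns, and the trace is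
the sum of all squared column norms. Convergence and compactness can thus be read from traces. -/
theorem abs_apply_le_trace {M : Matrix k k ℝ} (hM : 0 ≤ M) (a b : k) : |M a b| ≤ M.trace := by
  classical
  obtain ⟨B, rfl⟩ := exists_eq_transpose_mul_self hM
  have htr : (Bᵀ * B).trace = ∑ j, ∑ i, B i j ^ 2 := by
    simp [Matrix.trace, Matrix.mul_apply, sq]
  have hcol : ∀ c, ∑ i, B i c ^ 2 ≤ (Bᵀ * B).trace := fun c => by
    rw [htr]
    exact Finset.single_le_sum (f := fun j => ∑ i, B i j ^ 2)
      (fun j _ => Finset.sum_nonneg fun i _ => sq_nonneg _) (Finset.mem_univ c)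
  have h1 : |(Bᵀ * B) a b| ≤ ∑ i, (B i a ^ 2 + B i b ^ 2) / 2 := by
    rw [Matrix.mul_apply]
    refine (Finset.abs_sum_le_sum_abs _ _).trans (Finset.sum_le_sum fun i _ => ?_)
    rw [Matrix.transpose_apply, abs_mul]
    nlinarith [sq_nonneg (|B i a| - |B i b|), sq_abs (B i a), sq_abs (B i b)]
  rw [← Finset.sum_div, Finset.sum_add_distrib] at h1
  linarith [hcol a, hcol b]

theorem tendsto_matrix_iff {ι p q : Type*} {f : Filter ι} {M : ι → Matrix p q ℝ}
    {L : Matrix p q ℝ} :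
    Tendsto M f (𝓝 L) ↔ ∀ a b, Tendsto (fun t => M t a b) f (𝓝 (L a b)) := by
  refine tendsto_pi_nhds.trans ?_
  exact forall_congr' fun a => tendsto_pi_nhds

theorem tendsto_zero_of_trace {ι : Type*} {f : Filter ι} {M : ι → Matrix k k ℝ}
    (hM : ∀ t, 0 ≤ M t) (h : Tendsto (fun t => (M t).trace) f (𝓝 0)) : Tendsto M f (𝓝 0) :=
  tendsto_matrix_iff.2 fun a b => squeeze_zero_norm (fun t => abs_apply_le_trace (hM t) a b) h

theorem nonneg_of_tendsto {ι : Type*} {f : Filter ι} [f.NeBot] {M : ι → Matrix k k ℝ}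
    {L : Matrix k k ℝ} (h : Tendsto M f (𝓝 L)) (hM : ∀ t, 0 ≤ M t) : 0 ≤ L := by
  refine nonneg_iff_dotProduct.2 ⟨?_, fun x => ?_⟩
  · refine tendsto_nhds_unique (f := M) (l := f) ?_ h
    have := ((continuous_id.matrix_transpose).tendsto L).comp h
    refine this.congr fun t => ?_
    exact transpose_eq_of_nonneg (hM t)
  · have hc : Continuous fun Y : Matrix k k ℝ => x ⬝ᵥ Y *ᵥ x := by fun_prop
    exact ge_of_tendsto' ((hc.tendsto L).comp h) fun t => (nonneg_iff_dotProduct.1 (hM t)).2 x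

theorem le_of_tendsto_matrix {ι : Type*} {f : Filter ι} [f.NeBot] {M M' : ι → Matrix k k ℝ}
    {L L' : Matrix k k ℝ} (h : Tendsto M f (𝓝 L)) (h' : Tendsto M' f (𝓝 L'))
    (hM : ∀ t, M t ≤ M' t) : L ≤ L' :=
  sub_nonneg.1 (nonneg_of_tendsto (h'.sub h) fun t => sub_nonneg.2 (hM t))

theorem vecMulVec_le_smul_one [DecidableEq k] (g : k → ℝ) :
    vecMulVec g g ≤ (g ⬝ᵥ g) • (1 : Matrix k k ℝ) := by
  rw [← sub_nonneg]
  refine nonneg_iff_dotProduct.2 ⟨?_, fun x => ?_⟩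
  · simp [Matrix.transpose_sub, Matrix.transpose_vecMulVec]
  · rw [Matrix.sub_mulVec, Matrix.smul_mulVec, Matrix.one_mulVec, dotProduct_sub,
      dotProduct_smul, Matrix.vecMulVec_mulVec, smul_eq_mul]
    have := Finset.sum_mul_sq_le_sq_mul_sq Finset.univ g x
    simp only [dotProduct, Pi.smul_apply, MulOpposite.smul_eq_mul_unop, MulOpposite.unop_op,
      ← sq] at *
    have h2 : ∑ i, x i * (g i * ∑ j, g j * x j) = (∑ i, g i * x i) ^ 2 := by
      rw [sq, Finset.sum_mul]
      exact Finset.sum_congr rfl fun i _ => by ring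
    linarith

/-- With `P = Bᵀ B`, congruence by `B⁻¹` reduces the claim to `P = 1`. There `M` becomes a sum of
rank-one matrices, each dominated by its squared norm times the identity. -/
theorem exists_le_smul {P M : Matrix k k ℝ} (hP : P.PosDef) (hM : 0 ≤ M) :
    ∃ c : ℝ, 0 ≤ c ∧ M ≤ c • P := by
  classical
  obtain ⟨B, rfl⟩ := exists_eq_transpose_mul_self hP.zero_le
  have hB : IsUnit B.det := by
    have := (Matrix.isUnit_iff_isUnit_det _).1 hP.isUnit
    rw [Matrix.det_mul] at this
    exact isUnit_of_mul_isUnit_right this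
  obtain ⟨Y, hY⟩ := exists_eq_transpose_mul_self (conj_nonneg hM (B⁻¹)ᵀ)
  rw [Matrix.transpose_transpose, transpose_mul_self_eq_sum] at hY
  refine ⟨∑ a, Y a ⬝ᵥ Y a, Finset.sum_nonneg fun a _ => Finset.sum_nonneg fun i _ =>
    mul_self_nonneg _, ?_⟩
  have h1 : (B⁻¹)ᵀ * M * B⁻¹ ≤ (∑ a, Y a ⬝ᵥ Y a) • (1 : Matrix k k ℝ) := by
    rw [hY, Finset.sum_smul]
    exact Finset.sum_le_sum fun a _ => vecMulVec_le_smul_one _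
  have h2 := conj_mono h1 Bᵀ
  rw [Matrix.transpose_transpose, Matrix.mul_smul, Matrix.mul_one, Matrix.smul_mul] at h2
  have h3 : Bᵀ * ((B⁻¹)ᵀ * M * B⁻¹) * B = M := by
    rw [← Matrix.mul_assoc, ← Matrix.mul_assoc, ← Matrix.transpose_mul,
      Matrix.nonsing_inv_mul _ hB, Matrix.transpose_one, Matrix.one_mul, Matrix.mul_assoc,
      Matrix.nonsing_inv_mul _ hB, Matrix.mul_one]
  rwa [h3] at h2

theorem trace_mul_nonneg {Z M : Matrix k k ℝ} (hZ : 0 ≤ Z) (hM : 0 ≤ M) : 0 ≤ (Z * M).trace := by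
  obtain ⟨B, rfl⟩ := exists_eq_transpose_mul_self hM
  rw [← Matrix.mul_assoc, Matrix.trace_mul_comm, ← Matrix.mul_assoc]
  exact (Matrix.nonneg_iff_posSemidef.1 (conj_nonneg hZ B)).trace_nonneg

/-- For `Z = Yᵀ Y` and `R = Tᵀ T` the trace is the squared Frobenius norm of `Y B Tᵀ`. -/
theorem mul_eq_zero_of_trace_eq_zero {Z : Matrix k k ℝ} {B : Matrix k l ℝ} {R : Matrix l l ℝ}
    (hZ : 0 ≤ Z) (hR : 0 ≤ R) (h : (Z * (B * R * Bᵀ)).trace = 0) : Z * B * R = 0 := by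
  obtain ⟨Y, rfl⟩ := exists_eq_transpose_mul_self hZ
  obtain ⟨T, rfl⟩ := exists_eq_transpose_mul_self hR
  have h1 : Y * B * Tᵀ = 0 := by
    rw [← Matrix.trace_mul_conjTranspose_self_eq_zero_iff, conjTranspose_eq_transpose_of_trivial,
      ← h, Matrix.mul_assoc Yᵀ, Matrix.trace_mul_comm Yᵀ]
    simp only [Matrix.transpose_mul, Matrix.transpose_transpose, Matrix.mul_assoc]
  calc Yᵀ * Y * B * (Tᵀ * T) = Yᵀ * (Y * B * Tᵀ) * T := by simp only [Matrix.mul_assoc]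
    _ = 0 := by rw [h1, Matrix.mul_zero, Matrix.zero_mul]

end PositiveMatrices

end ProcessingNetwork

namespace ProcessingNetwork

open scoped MatrixOrder

/-! ### Mean square stability, and uniqueness for the Riccati equation -/

variable {n s : ℕ} {m : Fin (s + 1) → ℕ} (N : ProcessingNetwork n s m) (δ : Fin (s + 1) → ℕ)
  (I : Finset (Fin (s + 1))) (K : ∀ i, Matrix (Fin n) (Fin (m i)) ℝ)

/-- Mean square stability of the error dynamics with gains `K` of the sensors in `I`. -/
def IsStabilizing : Prop :=
  ∀ h : Fin n → ℝ, Tendsto (fun t => (N.propagate I K ^ t) (vecMulVec h h)) atTop (𝓝 0)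

theorem propagate_pow_nonneg (t : ℕ) {M : Matrix (Fin n) (Fin n) ℝ} (hM : 0 ≤ M) :
    0 ≤ (N.propagate I K ^ t) M := by
  induction t with
  | zero => simpa using hM
  | succ t ih =>
    rw [pow_succ', Module.End.mul_apply]
    exact N.propagate_nonneg I K ih

theorem propagate_pow_mono (t : ℕ) : Monotone (N.propagate I K ^ t) := fun M M' h => by
  have := N.propagate_pow_nonneg I K t (sub_nonneg.2 h)
  rw [map_sub] at this
  exact sub_nonneg.1 this

variable {N I K} in
theorem IsStabilizing.tendsto_zero (hK : N.IsStabilizing I K) {M : Matrix (Fin n) (Fin n) ℝ}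
    (hM : 0 ≤ M) : Tendsto (fun t => (N.propagate I K ^ t) M) atTop (𝓝 0) := by
  obtain ⟨B, rfl⟩ := exists_eq_transpose_mul_self hM
  simp only [transpose_mul_self_eq_sum, map_sum]
  simpa using tendsto_finsetSum Finset.univ fun a _ => hK (B a)

theorem covStep_iterate_sub (t : ℕ) (M M' : Matrix (Fin n) (Fin n) ℝ) :
    (N.covStep δ I K)^[t] M - (N.covStep δ I K)^[t] M' = (N.propagate I K ^ t) (M - M') := by
  induction t with
  | zero => simp
  | succ t ih =>
    rw [Function.iterate_succ_apply', Function.iterate_succ_apply', covStep_eq, covStep_eq,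
      add_sub_add_right_eq_sub, ← map_sub, ih, pow_succ', Module.End.mul_apply]

variable {N I K δ} in
-- The noise cancels in the difference of two trajectories, and what remains is contracted to zero:
-- the limit forgets the initial covariance.
theorem IsStabilizing.tendsto_covStep (hK : N.IsStabilizing I K)
    {M M' S : Matrix (Fin n) (Fin n) ℝ} (hM : 0 ≤ M) (hM' : 0 ≤ M')
    (h : Tendsto (fun t => (N.covStep δ I K)^[t] M) atTop (𝓝 S)) :
    Tendsto (fun t => (N.covStep δ I K)^[t] M') atTop (𝓝 S) := by
  have h1 := (hK.tendsto_zero hM').sub (hK.tendsto_zero hM)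
  simp only [← map_sub, ← N.covStep_iterate_sub δ] at h1
  simpa using h1.add h

variable {N I K δ} in
theorem IsStabilizing.tendsto_fixed (hK : N.IsStabilizing I K)
    {M S : Matrix (Fin n) (Fin n) ℝ} (hM : 0 ≤ M) (hS : 0 ≤ S) (h : N.covStep δ I K S = S) :
    Tendsto (fun t => (N.covStep δ I K)^[t] M) atTop (𝓝 S) := by
  refine hK.tendsto_covStep hS hM ?_
  simp only [Function.iterate_fixed h]
  exact tendsto_const_nhds

/-- The adjoint of `propagate` for the trace pairing. -/
noncomputable def propagateAdjoint :
    Matrix (Fin n) (Fin n) ℝ →ₗ[ℝ] Matrix (Fin n) (Fin n) ℝ where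
  toFun Z := (N.meanResidual I K)ᵀ * (N.Aᵀ * Z * N.A) * N.meanResidual I K +
    ∑ i ∈ I, (N.lam i * (1 - N.lam i)) • ((K i * N.C i)ᵀ * (N.Aᵀ * Z * N.A) * (K i * N.C i))
  map_add' Z Z' := by
    simp only [Matrix.mul_add, Matrix.add_mul, smul_add, Finset.sum_add_distrib]
    abel
  map_smul' c Z := by
    simp only [Matrix.mul_smul, Matrix.smul_mul, RingHom.id_apply, smul_add]
    simp only [smul_comm _ c, ← Finset.smul_sum]

theorem propagateAdjoint_apply (Z : Matrix (Fin n) (Fin n) ℝ) :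
    N.propagateAdjoint I K Z =
      (N.meanResidual I K)ᵀ * (N.Aᵀ * Z * N.A) * N.meanResidual I K +
    ∑ i ∈ I, (N.lam i * (1 - N.lam i)) • ((K i * N.C i)ᵀ * (N.Aᵀ * Z * N.A) * (K i * N.C i)) :=
  rfl

theorem trace_conj_comm {k : Type*} [Fintype k] (Z A X M : Matrix k k ℝ) :
    (Z * (A * (X * M * Xᵀ) * Aᵀ)).trace = (Xᵀ * (Aᵀ * Z * A) * X * M).trace := by
  have : Z * (A * (X * M * Xᵀ) * Aᵀ) = (Z * A * X * M) * (Xᵀ * Aᵀ) := by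
    simp only [Matrix.mul_assoc]
  rw [this, Matrix.trace_mul_comm]
  simp only [Matrix.mul_assoc]

theorem trace_mul_propagate (Z M : Matrix (Fin n) (Fin n) ℝ) :
    (Z * N.propagate I K M).trace = (N.propagateAdjoint I K Z * M).trace := by
  simp only [propagate_apply, propagateAdjoint_apply, Matrix.mul_add, Matrix.add_mul,
    Matrix.trace_add, trace_conj_comm, Matrix.mul_sum, Matrix.sum_mul, Matrix.trace_sum,
    Matrix.mul_smul, Matrix.smul_mul, Matrix.trace_smul]

theorem trace_mul_propagate_pow (t : ℕ) (Z M : Matrix (Fin n) (Fin n) ℝ) :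
    (Z * (N.propagate I K ^ t) M).trace = ((N.propagateAdjoint I K ^ t) Z * M).trace := by
  induction t generalizing M with
  | zero => simp
  | succ t ih =>
    rw [pow_succ, Module.End.mul_apply, ih, trace_mul_propagate, pow_succ', Module.End.mul_apply]

theorem propagateAdjoint_nonneg {Z : Matrix (Fin n) (Fin n) ℝ} (hZ : 0 ≤ Z) :
    0 ≤ N.propagateAdjoint I K Z := by
  have key : ∀ X : Matrix (Fin n) (Fin n) ℝ, 0 ≤ Xᵀ * (N.Aᵀ * Z * N.A) * X := fun X => by
    have := conj_nonneg (conj_nonneg hZ N.Aᵀ) Xᵀ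
    rwa [Matrix.transpose_transpose, Matrix.transpose_transpose] at this
  exact add_nonneg (key _) (Finset.sum_nonneg fun i _ =>
    matrix_smul_nonneg (key _) (mul_nonneg (N.lam_nonneg i) (N.one_sub_lam_nonneg i)))

theorem propagateAdjoint_pow_nonneg (t : ℕ) {Z : Matrix (Fin n) (Fin n) ℝ} (hZ : 0 ≤ Z) :
    0 ≤ (N.propagateAdjoint I K ^ t) Z := by
  induction t with
  | zero => simpa using hZ
  | succ t ih =>
    rw [pow_succ', Module.End.mul_apply]
    exact N.propagateAdjoint_nonneg I K ih

theorem propagateAdjoint_continuous : Continuous (N.propagateAdjoint I K) := by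
  change Continuous fun Z => (N.meanResidual I K)ᵀ * (N.Aᵀ * Z * N.A) * N.meanResidual I K +
    ∑ i ∈ I, (N.lam i * (1 - N.lam i)) • ((K i * N.C i)ᵀ * (N.Aᵀ * Z * N.A) * (K i * N.C i))
  fun_prop

theorem covStep_continuous : Continuous (N.covStep δ I K) := by
  change Continuous fun M => N.A * (N.meanResidual I K * M * (N.meanResidual I K)ᵀ +
    ∑ i ∈ I, N.lam i • (K i * ((1 - N.lam i) • (N.C i * M * (N.C i)ᵀ) + N.R i (δ i)) *
      (K i)ᵀ)) * N.Aᵀ + N.Q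
  fun_prop

theorem timeUpdate_continuous : Continuous N.timeUpdate := by
  change Continuous fun M => N.A * M * N.Aᵀ + N.Q
  fun_prop

theorem exists_tendsto_subseq_of_abs_le {Z : ℕ → Matrix (Fin n) (Fin n) ℝ} {c : ℝ}
    (h : ∀ t a b, |Z t a b| ≤ c) :
    ∃ L, ∃ φ : ℕ → ℕ, StrictMono φ ∧ Tendsto (fun t => Z (φ t)) atTop (𝓝 L) := by
  have : FirstCountableTopology (Matrix (Fin n) (Fin n) ℝ) :=
    inferInstanceAs (FirstCountableTopology (Fin n → Fin n → ℝ))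
  have hc : IsCompact (X := Matrix (Fin n) (Fin n) ℝ)
      (Set.univ.pi fun _ => Set.univ.pi fun _ => Set.Icc (-c) c) :=
    isCompact_univ_pi (X := fun _ : Fin n => Fin n → ℝ) fun _ =>
      isCompact_univ_pi fun _ => isCompact_Icc
  obtain ⟨L, -, φ, hφ, hL⟩ := hc.tendsto_subseq (x := fun t => (Z t : Fin n → Fin n → ℝ))
    fun t a _ b _ => abs_le.1 (h t a b)
  exact ⟨L, φ, hφ, hL⟩

/-- If `P` is positive definite and does not increase, but does not converge to zero either, then
the adjoint has an invariant positive semidefinite matrix that charges `P`. -/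
theorem exists_adjoint_fixed {P : Matrix (Fin n) (Fin n) ℝ} (hP : P.PosDef)
    (hdec : N.propagate I K P ≤ P) {ℓ : ℝ} (hℓ : 0 < ℓ)
    (hlow : ∀ t, ℓ ≤ ((N.propagate I K ^ t) P).trace) :
    ∃ Z, 0 ≤ Z ∧ N.propagateAdjoint I K Z = Z ∧ 0 < (Z * P).trace := by
  -- The adjoint orbit of the identity satisfies `tr (Y t P) = tr (Lᵗ P)` with `L` the propagation
  -- map, so its pairing with `P` stays at least `ℓ`.
  set Y : ℕ → Matrix (Fin n) (Fin n) ℝ := fun t => (N.propagateAdjoint I K ^ t) 1 with hY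
  have hY0 : ∀ t, 0 ≤ Y t := fun t =>
    N.propagateAdjoint_pow_nonneg I K t Matrix.PosSemidef.one.nonneg
  have hPt : ∀ t, (N.propagate I K ^ t) P ≤ P := fun t => by
    induction t with
    | zero => simp
    | succ t ih =>
      rw [pow_succ', Module.End.mul_apply]
      exact (N.propagate_mono I K ih).trans hdec
  have htrace : ∀ {M M' : Matrix (Fin n) (Fin n) ℝ}, M ≤ M' → M.trace ≤ M'.trace :=
    fun {M M'} h => by
      have := (Matrix.le_iff.1 h).trace_nonneg
      rw [Matrix.trace_sub] at this
      linarith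
  have hYP : ∀ t, (Y t * P).trace = ((N.propagate I K ^ t) P).trace := fun t => by
    rw [← N.trace_mul_propagate_pow, Matrix.one_mul]
  -- Positive definiteness of `P` bounds the orbit: `1 ⪯ c P` gives `tr (Y t) ≤ c tr (Y t P) ≤ c tr
  -- P`.
  obtain ⟨c, hc0, hc⟩ := exists_le_smul hP (Matrix.PosSemidef.one (n := Fin n) (R := ℝ)).nonneg
  have hYtr : ∀ t, (Y t).trace ≤ c * P.trace := fun t => by
    have h1 := trace_mul_nonneg (hY0 t) (sub_nonneg.2 hc)
    rw [Matrix.mul_sub, Matrix.trace_sub, Matrix.mul_one, Matrix.mul_smul, Matrix.trace_smul, hYP,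
      smul_eq_mul] at h1
    have h2 := mul_le_mul_of_nonneg_left (htrace (hPt t)) hc0
    linarith
  have hYab : ∀ t a b, |Y t a b| ≤ c * P.trace := fun t a b =>
    (abs_apply_le_trace (hY0 t) a b).trans (hYtr t)
  -- Cesàro means: they inherit both bounds, and applying the adjoint changes them only by a
  -- telescoped boundary term of order `1 / (T + 1)`, so every limit point is invariant.
  set Z : ℕ → Matrix (Fin n) (Fin n) ℝ := fun T =>
    ((T : ℝ) + 1)⁻¹ • ∑ t ∈ Finset.range (T + 1), Y t with hZ
  have hpos : ∀ T : ℕ, (0 : ℝ) < (T : ℝ) + 1 := fun T => by positivity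
  have hZ0 : ∀ T, 0 ≤ Z T := fun T =>
    matrix_smul_nonneg (Finset.sum_nonneg fun t _ => hY0 t) (inv_nonneg.2 (hpos T).le)
  have hZab : ∀ T a b, |Z T a b| ≤ c * P.trace := fun T a b => by
    refine (abs_apply_le_trace (hZ0 T) a b).trans ?_
    rw [hZ, Matrix.trace_smul, Matrix.trace_sum, smul_eq_mul, inv_mul_le_iff₀ (hpos T)]
    refine (Finset.sum_le_sum fun t _ => hYtr t).trans_eq ?_
    simp
  have hZP : ∀ T, ℓ ≤ (Z T * P).trace := fun T => by
    rw [hZ, Matrix.smul_mul, Matrix.trace_smul, Matrix.sum_mul, Matrix.trace_sum, smul_eq_mul,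
      le_inv_mul_iff₀ (hpos T)]
    have : ∑ t ∈ Finset.range (T + 1), ℓ ≤ ∑ t ∈ Finset.range (T + 1), (Y t * P).trace :=
      Finset.sum_le_sum fun t _ => by rw [hYP]; exact hlow t
    simpa using this
  have hdiff : ∀ T, N.propagateAdjoint I K (Z T) - Z T =
      ((T : ℝ) + 1)⁻¹ • (Y (T + 1) - Y 0) := fun T => by
    rw [hZ, map_smul, ← smul_sub, map_sum]
    congr 1
    rw [← Finset.sum_range_sub, ← Finset.sum_sub_distrib]
    refine Finset.sum_congr rfl fun t _ => ?_
    rw [hY]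
    simp only
    rw [pow_succ', Module.End.mul_apply]
  obtain ⟨L, φ, hφ, hL⟩ := exists_tendsto_subseq_of_abs_le hZab
  refine ⟨L, nonneg_of_tendsto hL fun t => hZ0 _, ?_, ?_⟩
  · have h1 : Tendsto (fun t => N.propagateAdjoint I K (Z (φ t)) - Z (φ t)) atTop
        (𝓝 (N.propagateAdjoint I K L - L)) :=
      (((N.propagateAdjoint_continuous I K).tendsto L).comp hL).sub hL
    have h2 : Tendsto (fun T => N.propagateAdjoint I K (Z T) - Z T) atTop (𝓝 0) := by
      simp only [hdiff]
      refine tendsto_matrix_iff.2 fun a b => ?_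
      have h3 : Tendsto (fun T : ℕ => ((T : ℝ) + 1)⁻¹) atTop (𝓝 0) := by
        simpa using tendsto_one_div_add_atTop_nhds_zero_nat (𝕜 := ℝ)
      have h4 : Tendsto (fun T : ℕ => ((T : ℝ) + 1)⁻¹ * (2 * (c * P.trace))) atTop (𝓝 0) := by
        simpa using h3.mul_const (2 * (c * P.trace))
      refine squeeze_zero_norm (fun T => ?_) h4
      rw [Matrix.smul_apply, smul_eq_mul, norm_mul, Real.norm_of_nonneg (inv_nonneg.2 (hpos T).le)]
      refine mul_le_mul_of_nonneg_left ?_ (inv_nonneg.2 (hpos T).le)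
      rw [Matrix.sub_apply, Real.norm_eq_abs]
      have := abs_sub (Y (T + 1) a b) (Y 0 a b)
      linarith [hYab (T + 1) a b, hYab 0 a b]
    exact sub_eq_zero.1 (tendsto_nhds_unique h1 (h2.comp hφ.tendsto_atTop))
  · have hcont : Continuous fun M : Matrix (Fin n) (Fin n) ℝ => (M * P).trace := by fun_prop
    exact hℓ.trans_le (ge_of_tendsto' ((hcont.tendsto L).comp hL) fun t => hZP _)

variable {δ} in
/-- No invariant matrix of the adjoint of the closed loop charges a positive definite solution of the
ARE if some gains are stabilizing. -/
theorem trace_eq_zero_of_adjoint_fixed (hδ : ∀ i, 0 < δ i) {d : ℕ}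
    {P : Matrix (Fin n) (Fin n) ℝ} (hP : P.PosDef) (hfix : N.kfStep δ d P = P)
    (hK : N.IsStabilizing (N.activeSensors δ d) K) {Z : Matrix (Fin n) (Fin n) ℝ} (hZ : 0 ≤ Z)
    (hinv : N.propagateAdjoint (N.activeSensors δ d) (N.kalmanGain δ d P) Z = Z) :
    (Z * P).trace = 0 := by
  set I := N.activeSensors δ d with hI
  set κ := N.kalmanGain δ d P with hκ
  set U := N.measUpdate δ d P with hU
  have hPt : Pᵀ = P := transpose_eq_of_nonneg hP.zero_le
  have hZt : Zᵀ = Z := transpose_eq_of_nonneg hZ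
  have hcov : N.propagate I κ P + N.injectedNoise δ I κ = P := by
    rw [← covStep_eq, N.covStep_kalmanGain hδ d hP, hfix]
  -- Pair the Riccati equation with `Z`: by invariance the propagated part already accounts for all
  -- of `tr (Z P)`.
  have htr : (Z * N.injectedNoise δ I κ).trace = 0 := by
    have h1 := N.trace_mul_propagate I κ Z P
    rw [hinv] at h1
    have h2 := congrArg (fun M => (Z * M).trace) hcov
    simp only [Matrix.mul_add, Matrix.trace_add] at h2
    linarith
  have hterm : ∀ i, 0 ≤ (Z * (N.A * κ i * N.R i (δ i) * (N.A * κ i)ᵀ)).trace := fun i =>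
    trace_mul_nonneg hZ (conj_nonneg (N.R_posDef' hδ i).zero_le _)
  have hQtr : 0 ≤ (Z * N.Q).trace := trace_mul_nonneg hZ N.Q_nonneg
  have hexp : (Z * N.injectedNoise δ I κ).trace =
      ∑ i ∈ I, N.lam i * (Z * (N.A * κ i * N.R i (δ i) * (N.A * κ i)ᵀ)).trace +
        (Z * N.Q).trace := by
    simp only [injectedNoise, Matrix.mul_add, Matrix.trace_add, Matrix.mul_sum, Matrix.sum_mul,
      Matrix.trace_sum, Matrix.mul_smul, Matrix.smul_mul, Matrix.trace_smul, smul_eq_mul,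
      Matrix.transpose_mul, Matrix.mul_assoc]
  have hsum : 0 ≤ ∑ i ∈ I, N.lam i * (Z * (N.A * κ i * N.R i (δ i) * (N.A * κ i)ᵀ)).trace :=
    Finset.sum_nonneg fun i _ => mul_nonneg (N.lam_nonneg i) (hterm i)
  have hZQ : Z * N.Q = 0 := by
    have := mul_eq_zero_of_trace_eq_zero (Z := Z) (B := 1) (R := N.Q) hZ N.Q_nonneg (by
      rw [Matrix.one_mul, Matrix.transpose_one, Matrix.mul_one]; linarith)
    rwa [Matrix.mul_one] at this
  -- The weight stays in the statement because a sensor with `λ = 0` imposes no constraint.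
  have hZK : ∀ i ∈ I, N.lam i • (Z * (N.A * κ i)) = 0 := fun i hi => by
    have h1 := (Finset.sum_eq_zero_iff_of_nonneg fun i _ =>
      mul_nonneg (N.lam_nonneg i) (hterm i)).1 (by linarith) i hi
    rcases mul_eq_zero.1 h1 with h2 | h2
    · rw [h2, zero_smul]
    · have h3 := mul_eq_zero_of_trace_eq_zero hZ (N.R_posDef' hδ i).zero_le h2
      have h4 : Z * (N.A * κ i) = 0 := by
        rw [← Matrix.mul_one (Z * (N.A * κ i)), ← mul_inv_of_posDef (N.R_posDef' hδ i),
          ← Matrix.mul_assoc, h3, Matrix.zero_mul]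
      rw [h4, smul_zero]
  have hZAX : Z * N.A * N.meanResidual I κ = Z * N.A := by
    rw [meanResidual, Matrix.mul_sub, Matrix.mul_one, sub_eq_self, Matrix.mul_sum]
    refine Finset.sum_eq_zero fun i hi => ?_
    rw [Matrix.mul_smul, ← Matrix.mul_assoc, Matrix.mul_assoc Z, ← Matrix.smul_mul, hZK i hi,
      Matrix.zero_mul]
  -- Since `Z` does not see the gains, the closed loop acts on it like the open loop.
  have hAZA : N.Aᵀ * Z * N.A = Z := by
    have h1 : N.Aᵀ * Z * N.A * N.meanResidual I κ = N.Aᵀ * Z * N.A := by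
      rw [Matrix.mul_assoc N.Aᵀ, Matrix.mul_assoc N.Aᵀ, hZAX]
    have h2 : (N.meanResidual I κ)ᵀ * (N.Aᵀ * Z * N.A) = N.Aᵀ * Z * N.A := by
      have := congrArg Matrix.transpose h1
      simp only [Matrix.transpose_mul, Matrix.transpose_transpose, hZt] at this
      simpa only [Matrix.mul_assoc] using this
    conv_rhs => rw [← hinv]
    rw [propagateAdjoint_apply, h2, h1, left_eq_add]
    refine Finset.sum_eq_zero fun i hi => ?_
    have : N.lam i • (N.Aᵀ * Z * N.A * (κ i * N.C i)) = 0 := by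
      have h3 : N.Aᵀ * Z * N.A * (κ i * N.C i) = N.Aᵀ * (Z * (N.A * κ i)) * N.C i := by
        simp only [Matrix.mul_assoc]
      rw [h3, ← Matrix.smul_mul, ← Matrix.mul_smul, hZK i hi, Matrix.mul_zero, Matrix.zero_mul]
    rw [mul_comm, mul_smul, Matrix.mul_assoc (κ i * N.C i)ᵀ, ← Matrix.mul_smul, this,
      Matrix.mul_zero, smul_zero]
  have hZAU : ∀ i ∈ I, N.lam i • (Z * N.A * U * (N.C i)ᵀ) = 0 := fun i hi => by
    have h1 : Z * N.A * U * (N.C i)ᵀ = Z * (N.A * κ i) * N.inflatedNoise δ P i := by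
      rw [Matrix.mul_assoc (Z * N.A), ← N.kalmanGain_mul_inflatedNoise hδ d hP i]
      simp only [Matrix.mul_assoc, hκ]
    rw [h1, ← Matrix.smul_mul, hZK i hi, Matrix.zero_mul]
  -- Multiply `U (P⁻¹ + D) = 1` on the left by `Z A`; the data information `D` drops out because
  -- each weighted `Z A U Cᵀ` vanishes.
  have hUP : Z * N.A * U = Z * N.A * P := by
    have h1 : Z * N.A * U * (P⁻¹ + N.dataInfo δ d P) = Z * N.A := by
      rw [Matrix.mul_assoc, hU, measUpdate,
        inv_mul_of_posDef (N.posDef_inv_add_dataInfo hδ d hP), Matrix.mul_one]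
    have h2 : Z * N.A * U * N.dataInfo δ d P = 0 := by
      rw [N.dataInfo_eq hδ d hP, Matrix.mul_sum]
      refine Finset.sum_eq_zero fun i hi => ?_
      rw [Matrix.mul_smul, ← Matrix.mul_assoc, ← Matrix.mul_assoc, ← Matrix.smul_mul,
        ← Matrix.smul_mul, hZAU i hi, Matrix.zero_mul, Matrix.zero_mul]
    rw [Matrix.mul_add, h2, add_zero] at h1
    calc Z * N.A * U = Z * N.A * U * P⁻¹ * P := by
          rw [Matrix.mul_assoc _ P⁻¹, inv_mul_of_posDef hP, Matrix.mul_one]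
      _ = Z * N.A * P := by rw [h1]
  have hZP : Z * N.A * P * N.Aᵀ = Z * P := by
    rw [← hUP]
    conv_rhs => rw [← hfix]
    rw [kfStep, timeUpdate, Matrix.mul_add, hZQ, add_zero]
    simp only [Matrix.mul_assoc, hU]
  have hPZ : N.A * P * N.Aᵀ * Z = P * Z := by
    have := congrArg Matrix.transpose hZP
    simp only [Matrix.transpose_mul, Matrix.transpose_transpose, hZt, hPt] at this
    simpa only [Matrix.mul_assoc] using this
  have hZPC : ∀ i ∈ I, N.lam i • (Z * P * (N.C i)ᵀ) = 0 := fun i hi => by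
    have h1 : Z * P * (N.C i)ᵀ = N.Aᵀ * (Z * N.A * U * (N.C i)ᵀ) := by
      rw [hUP]
      conv_lhs => rw [← hAZA]
      simp only [Matrix.mul_assoc]
    rw [h1, ← Matrix.mul_smul, hZAU i hi, Matrix.mul_zero]
  -- `M` satisfies `A M Aᵀ = M` and is invisible to every sensor in `I` with `λ ≠ 0`. Hence it is
  -- fixed by the propagation with any gains, in particular the stabilizing gains `K`, which forces
  -- `M = 0`.
  set M := P * Z * P with hMdef
  have hM0 : 0 ≤ M := by
    have := conj_nonneg hZ P
    rwa [hPt] at this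
  have hMt : Mᵀ = M := transpose_eq_of_nonneg hM0
  have hMC : ∀ i ∈ I, N.lam i • (M * (K i * N.C i)ᵀ) = 0 := fun i hi => by
    have h1 : M * (K i * N.C i)ᵀ = P * (Z * P * (N.C i)ᵀ) * (K i)ᵀ := by
      simp only [hMdef, Matrix.transpose_mul, Matrix.mul_assoc]
    rw [h1, ← Matrix.smul_mul, ← Matrix.mul_smul, hZPC i hi, Matrix.mul_zero, Matrix.zero_mul]
  have hAMA : N.A * M * N.Aᵀ = M := by
    calc N.A * M * N.Aᵀ = N.A * P * Z * (P * N.Aᵀ) := by simp only [hMdef, Matrix.mul_assoc]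
      _ = N.A * P * (N.Aᵀ * Z * N.A) * (P * N.Aᵀ) := by rw [hAZA]
      _ = (N.A * P * N.Aᵀ * Z) * (N.A * P * N.Aᵀ) := by simp only [Matrix.mul_assoc]
      _ = P * (Z * N.A * P * N.Aᵀ) := by rw [hPZ]; simp only [Matrix.mul_assoc]
      _ = M := by rw [hZP, hMdef, Matrix.mul_assoc]
  have hMX : M * (N.meanResidual I K)ᵀ = M := by
    rw [meanResidual, Matrix.transpose_sub, Matrix.transpose_one, Matrix.mul_sub, Matrix.mul_one,
      sub_eq_self, Matrix.transpose_sum, Matrix.mul_sum]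
    refine Finset.sum_eq_zero fun i hi => ?_
    rw [Matrix.transpose_smul, Matrix.mul_smul, hMC i hi]
  have hXM : N.meanResidual I K * M = M := by
    have := congrArg Matrix.transpose hMX
    rwa [Matrix.transpose_mul, Matrix.transpose_transpose, hMt] at this
  have hpM : N.propagate I K M = M := by
    rw [propagate_apply, hXM, hMX, Finset.sum_eq_zero, add_zero, hAMA]
    intro i hi
    rw [mul_comm, mul_smul, Matrix.mul_assoc, ← Matrix.mul_smul, hMC i hi, Matrix.mul_zero,
      smul_zero]
  have hpow : ∀ t, (N.propagate I K ^ t) M = M := fun t => by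
    induction t with
    | zero => simp
    | succ t ih => rw [pow_succ, Module.End.mul_apply, hpM, ih]
  have hMzero : M = 0 := by
    refine tendsto_nhds_unique (f := fun _ : ℕ => M) (l := atTop) tendsto_const_nhds ?_
    simpa only [hpow] using hK.tendsto_zero hM0
  have hZP0 : Z * P = 0 := by
    calc Z * P = P⁻¹ * M := by
          rw [hMdef, Matrix.mul_assoc, ← Matrix.mul_assoc, inv_mul_of_posDef hP, Matrix.one_mul]
      _ = 0 := by rw [hMzero, Matrix.mul_zero]
  rw [hZP0, Matrix.trace_zero]

variable {δ} in
/-- The Kalman gains of a positive definite solution of the ARE are stabilizing as soon as some gains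
are. -/
theorem isStabilizing_kalmanGain (hδ : ∀ i, 0 < δ i) {d : ℕ}
    {P : Matrix (Fin n) (Fin n) ℝ} (hP : P.PosDef) (hfix : N.kfStep δ d P = P)
    (hK : N.IsStabilizing (N.activeSensors δ d) K) :
    N.IsStabilizing (N.activeSensors δ d) (N.kalmanGain δ d P) := by
  set I := N.activeSensors δ d with hI
  set κ := N.kalmanGain δ d P with hκ
  have hdec : N.propagate I κ P ≤ P := by
    have : N.propagate I κ P + N.injectedNoise δ I κ = P := by
      rw [← covStep_eq, N.covStep_kalmanGain hδ d hP, hfix]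
    conv_rhs => rw [← this]
    exact le_add_of_nonneg_right (N.injectedNoise_nonneg I κ hδ)
  have hnn : ∀ t, 0 ≤ (N.propagate I κ ^ t) P := fun t => N.propagate_pow_nonneg I κ t hP.zero_le
  have hanti : Antitone fun t => ((N.propagate I κ ^ t) P).trace := by
    refine antitone_nat_of_succ_le fun t => ?_
    rw [pow_succ, Module.End.mul_apply]
    have := (Matrix.le_iff.1 (N.propagate_pow_mono I κ t hdec)).trace_nonneg
    rw [Matrix.trace_sub] at this
    linarith
  have hbdd : BddBelow (Set.range fun t => ((N.propagate I κ ^ t) P).trace) :=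
    ⟨0, by rintro _ ⟨t, rfl⟩; exact (Matrix.nonneg_iff_posSemidef.1 (hnn t)).trace_nonneg⟩
  have hlim := tendsto_atTop_ciInf hanti hbdd
  have hℓ : (⨅ t, ((N.propagate I κ ^ t) P).trace) = 0 := by
    refine le_antisymm (not_lt.1 fun hpos => ?_)
      (le_ciInf fun t => (Matrix.nonneg_iff_posSemidef.1 (hnn t)).trace_nonneg)
    obtain ⟨Z, hZ, hinv, hZP⟩ := N.exists_adjoint_fixed I κ hP hdec hpos fun t => ciInf_le hbdd t
    exact hZP.ne' (N.trace_eq_zero_of_adjoint_fixed K hδ hP hfix hK hZ hinv)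
  rw [hℓ] at hlim
  intro h
  -- Every rank-one matrix is dominated by a multiple of `P`, so the decay of the trace of the
  -- propagated `P` is enough.
  obtain ⟨c, hc0, hc⟩ := exists_le_smul hP (vecMulVec_nonneg h)
  have hle : ∀ t, (N.propagate I κ ^ t) (vecMulVec h h) ≤ c • (N.propagate I κ ^ t) P := fun t => by
    rw [← map_smul]
    exact N.propagate_pow_mono I κ t hc
  refine tendsto_zero_of_trace (fun t => N.propagate_pow_nonneg I κ t (vecMulVec_nonneg h)) ?_
  refine squeeze_zero (fun t => (Matrix.nonneg_iff_posSemidef.1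
    (N.propagate_pow_nonneg I κ t (vecMulVec_nonneg h))).trace_nonneg) (fun t => ?_)
    (by simpa using hlim.const_mul c)
  have := (Matrix.le_iff.1 (hle t)).trace_nonneg
  rw [Matrix.trace_sub, Matrix.trace_smul, smul_eq_mul] at this
  linarith

variable {N I K δ} in
-- A subsolution of a monotone recursion stays below every trajectory that starts above it.
theorem le_of_covStep_tendsto {P S M : Matrix (Fin n) (Fin n) ℝ} (hP : P ≤ N.covStep δ I K P)
    (hPM : P ≤ M) (h : Tendsto (fun t => (N.covStep δ I K)^[t] M) atTop (𝓝 S)) : P ≤ S := by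
  refine le_of_tendsto_matrix tendsto_const_nhds h fun t => ?_
  induction t with
  | zero => exact hPM
  | succ t ih =>
    rw [Function.iterate_succ_apply']
    exact hP.trans (N.covStep_mono δ I K ih)

variable {δ} in
-- By optimality of the Kalman gain, each solution is a subsolution of the recursion with the gains
-- of the other. That recursion is stable and converges to the other solution, so the two dominate
-- each other.
theorem fixed_unique (hδ : ∀ i, 0 < δ i) {d : ℕ}
    {P P' : Matrix (Fin n) (Fin n) ℝ} (hP : P.PosDef) (hfix : N.kfStep δ d P = P)
    (hP' : P'.PosDef) (hfix' : N.kfStep δ d P' = P')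
    (hK : N.IsStabilizing (N.activeSensors δ d) K) : P = P' := by
  have key : ∀ {X Y : Matrix (Fin n) (Fin n) ℝ}, X.PosDef → N.kfStep δ d X = X → Y.PosDef →
      N.kfStep δ d Y = Y → X ≤ Y := fun {X Y} hX hfX hY hfY => by
    have hle := N.kfStep_le_covStep (N.kalmanGain δ d Y) hδ d hX
    rw [hfX] at hle
    exact le_of_covStep_tendsto hle le_rfl
      ((N.isStabilizing_kalmanGain K hδ hY hfY hK).tendsto_fixed hX.zero_le hY.zero_le
        ((N.covStep_kalmanGain hδ d hY).trans hfY))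
  exact le_antisymm (key hP hfix hP' hfix') (key hP' hfix' hP hfix)

end ProcessingNetwork

namespace ProcessingNetwork

open scoped MatrixOrder

/-! ### Limits of monotone sequences and of inverses -/

section Convergence

variable {k : Type*} [Fintype k]

/-- The traces converge, being decreasing and nonnegative, and trace differences bound the
differences of entries, which are therefore Cauchy. -/
theorem exists_tendsto_of_antitone {M : ℕ → Matrix k k ℝ} (hM : ∀ t, 0 ≤ M t) (h : Antitone M) :
    ∃ L, Tendsto M atTop (𝓝 L) := by
  have htr : ∀ {t u}, t ≤ u → 0 ≤ (M t).trace - (M u).trace := fun {t u} htu => by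
    rw [← Matrix.trace_sub]
    exact (Matrix.le_iff.1 (h htu)).trace_nonneg
  have hlim := tendsto_atTop_ciInf (f := fun t => (M t).trace)
    (fun t u htu => sub_nonneg.1 (htr htu))
    ⟨0, by rintro _ ⟨t, rfl⟩; exact (Matrix.nonneg_iff_posSemidef.1 (hM t)).trace_nonneg⟩
  set ℓ := ⨅ t, (M t).trace
  have hℓ : ∀ t, ℓ ≤ (M t).trace := fun t =>
    le_of_tendsto hlim (eventually_atTop.2 ⟨t, fun u hu => sub_nonneg.1 (htr hu)⟩)
  have hc : ∀ a b, ∃ l, Tendsto (fun t => M t a b) atTop (𝓝 l) := fun a b => by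
    refine cauchySeq_tendsto_of_complete
      (cauchySeq_of_le_tendsto_0' (fun t => (M t).trace - ℓ) (fun t u htu => ?_)
        (by simpa using hlim.sub_const ℓ))
    have h1 := abs_apply_le_trace (sub_nonneg.2 (h htu)) a b
    rw [Matrix.sub_apply, Matrix.trace_sub] at h1
    rw [Real.dist_eq]
    linarith [hℓ u]
  choose L hL using hc
  exact ⟨L, tendsto_matrix_iff.2 hL⟩

theorem tendsto_matrix_inv [DecidableEq k] {ι : Type*} {f : Filter ι} {M : ι → Matrix k k ℝ}
    {L : Matrix k k ℝ} (hL : L.PosDef) (h : Tendsto M f (𝓝 L)) :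
    Tendsto (fun t => (M t)⁻¹) f (𝓝 L⁻¹) := by
  refine (continuousAt_matrix_inv L ?_).tendsto.comp h
  rw [Ring.inverse_eq_inv']
  exact continuousAt_inv₀ hL.det_pos.ne'

end Convergence

/-! ### Controllability and existence for the Riccati equation -/

variable {n s : ℕ} {m : Fin (s + 1) → ℕ} (N : ProcessingNetwork n s m) (δ : Fin (s + 1) → ℕ)
  (I : Finset (Fin (s + 1))) (K : ∀ i, Matrix (Fin n) (Fin (m i)) ℝ)

theorem posDef_of_dotProduct_eq_zero {M : Matrix (Fin n) (Fin n) ℝ} (hM : 0 ≤ M)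
    (h : ∀ x, x ⬝ᵥ M *ᵥ x = 0 → x = 0) : M.PosDef := by
  refine Matrix.PosDef.of_dotProduct_mulVec_pos (Matrix.nonneg_iff_posSemidef.1 hM).isHermitian
    fun x hx => ?_
  rw [star_trivial]
  exact ((nonneg_iff_dotProduct.1 hM).2 x).lt_of_ne' fun h0 => hx (h x h0)

theorem mulVec_eq_zero_of_dotProduct {k : Type*} [Fintype k] {M : Matrix k k ℝ} (hM : 0 ≤ M)
    {x : k → ℝ} (h : x ⬝ᵥ M *ᵥ x = 0) : M *ᵥ x = 0 := by
  rw [← star_trivial x] at h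
  simpa using ((Matrix.nonneg_iff_posSemidef.1 hM).dotProduct_mulVec_zero_iff (star x)).1
    (by simpa using h)

theorem dotProduct_conj_mulVec {k l : Type*} [Fintype k] [Fintype l] (B : Matrix k l ℝ)
    (M : Matrix l l ℝ) (x : k → ℝ) :
    x ⬝ᵥ (B * M * Bᵀ) *ᵥ x = (Bᵀ *ᵥ x) ⬝ᵥ M *ᵥ (Bᵀ *ᵥ x) := by
  rw [← Matrix.mulVec_mulVec, ← Matrix.mulVec_mulVec, Matrix.dotProduct_mulVec,
    ← Matrix.mulVec_transpose]

variable {N} in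
theorem IsControllable.eq_zero (hc : N.IsControllable) {x : Fin n → ℝ}
    (h : ∀ j, N.Q *ᵥ ((N.Aᵀ) ^ j *ᵥ x) = 0) : x = 0 := by
  by_contra hx
  have := hc.dotProduct_mulVec_pos hx
  rw [Matrix.sum_mulVec, Finset.sum_eq_zero, dotProduct_zero] at this
  · exact lt_irrefl _ this
  · intro j _
    rw [← Matrix.mulVec_mulVec, ← Matrix.mulVec_mulVec, h, Matrix.mulVec_zero]

variable {N} in
/-- A set of directions that is invariant and not excited by the system noise is trivial. -/
theorem IsControllable.eq_zero_of_invariant (hc : N.IsControllable) {p : (Fin n → ℝ) → Prop}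
    (hp : ∀ x, p x → N.Q *ᵥ x = 0 ∧ p (N.Aᵀ *ᵥ x)) {x : Fin n → ℝ} (hx : p x) : x = 0 := by
  have h : ∀ j, p ((N.Aᵀ) ^ j *ᵥ x) := fun j => by
    induction j with
    | zero => simpa using hx
    | succ j ih =>
      rw [pow_succ', ← Matrix.mulVec_mulVec]
      exact (hp _ ih).2
  exact hc.eq_zero fun j => (hp _ (h j)).1

variable {N δ I K} in
-- If `x` is in the kernel of `S`, every positive semidefinite summand of the fixed-point equation
-- vanishes at `x`. So `Q x = 0`, the effective gains kill `Aᵀ x`, the residual therefore fixes it,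
-- and `Aᵀ x` is in the kernel of `S` again.
theorem IsControllable.posDef_of_fixed (hc : N.IsControllable) (hδ : ∀ i, 0 < δ i)
    {S : Matrix (Fin n) (Fin n) ℝ} (hS : 0 ≤ S) (h : N.covStep δ I K S = S) : S.PosDef := by
  refine posDef_of_dotProduct_eq_zero hS fun x hx =>
    hc.eq_zero_of_invariant (p := fun x => x ⬝ᵥ S *ᵥ x = 0) (fun x hx => ?_) hx
  have hJ1 : 0 ≤ N.meanResidual I K * S * (N.meanResidual I K)ᵀ := conj_nonneg hS _
  have hJ2 : ∀ i, 0 ≤ K i * N.inflatedNoise δ S i * (K i)ᵀ := fun i =>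
    conj_nonneg (N.inflatedNoise_posDef hδ hS i).zero_le _
  have hJ3 : 0 ≤ ∑ i ∈ I, N.lam i • (K i * N.inflatedNoise δ S i * (K i)ᵀ) :=
    Finset.sum_nonneg fun i _ => matrix_smul_nonneg (hJ2 i) (N.lam_nonneg i)
  have h0 := hx
  rw [← h, covStep, timeUpdate, Matrix.add_mulVec, dotProduct_add, dotProduct_conj_mulVec,
    josephUpdate, Matrix.add_mulVec, dotProduct_add] at h0
  set y := N.Aᵀ *ᵥ x with hy
  have p1 := (nonneg_iff_dotProduct.1 hJ1).2 y
  have p2 := (nonneg_iff_dotProduct.1 hJ3).2 y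
  have p3 := (nonneg_iff_dotProduct.1 N.Q_nonneg).2 x
  have e1 : y ⬝ᵥ (N.meanResidual I K * S * (N.meanResidual I K)ᵀ) *ᵥ y = 0 := by linarith
  have e2 : y ⬝ᵥ (∑ i ∈ I, N.lam i • (K i * N.inflatedNoise δ S i * (K i)ᵀ)) *ᵥ y = 0 := by
    linarith
  have e3 : x ⬝ᵥ N.Q *ᵥ x = 0 := by linarith
  refine ⟨mulVec_eq_zero_of_dotProduct N.Q_nonneg e3, ?_⟩
  have hK : ∀ i ∈ I, N.lam i • ((K i)ᵀ *ᵥ y) = 0 := fun i hi => by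
    have hterm : ∀ i ∈ I, 0 ≤ N.lam i * (y ⬝ᵥ (K i * N.inflatedNoise δ S i * (K i)ᵀ) *ᵥ y) :=
      fun i _ => mul_nonneg (N.lam_nonneg i) ((nonneg_iff_dotProduct.1 (hJ2 i)).2 y)
    have e4 : ∑ i ∈ I, N.lam i * (y ⬝ᵥ (K i * N.inflatedNoise δ S i * (K i)ᵀ) *ᵥ y) = 0 := by
      rw [← e2, Matrix.sum_mulVec, dotProduct_sum]
      simp only [Matrix.smul_mulVec, dotProduct_smul, smul_eq_mul]
    rcases mul_eq_zero.1 ((Finset.sum_eq_zero_iff_of_nonneg hterm).1 e4 i hi) with e5 | e5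
    · rw [e5, zero_smul]
    · rw [dotProduct_conj_mulVec] at e5
      by_contra hne
      have := (N.inflatedNoise_posDef hδ hS i).dotProduct_mulVec_pos
        (x := (K i)ᵀ *ᵥ y) fun h0 => hne (by rw [h0, smul_zero])
      rw [star_trivial, e5] at this
      exact lt_irrefl _ this
  have hX : (N.meanResidual I K)ᵀ *ᵥ y = y := by
    rw [meanResidual, Matrix.transpose_sub, Matrix.transpose_one, Matrix.sub_mulVec,
      Matrix.one_mulVec, sub_eq_self, Matrix.transpose_sum, Matrix.sum_mulVec]
    refine Finset.sum_eq_zero fun i hi => ?_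
    rw [Matrix.transpose_smul, Matrix.transpose_mul, Matrix.smul_mulVec, ← Matrix.mulVec_mulVec,
      ← Matrix.mulVec_smul, hK i hi, Matrix.mulVec_zero]
  rwa [dotProduct_conj_mulVec, hX] at e1

variable {N δ} in
-- Here invariance of the kernel is degenerate: the updated covariance is positive definite, so `Aᵀ
-- x = 0` for `x` in the kernel.
theorem IsControllable.kfStep_posDef (hc : N.IsControllable) (hδ : ∀ i, 0 < δ i) (d : ℕ)
    {P : Matrix (Fin n) (Fin n) ℝ} (hP : P.PosDef) : (N.kfStep δ d P).PosDef := by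
  have hU := N.measUpdate_posDef hδ d hP
  have hA := conj_nonneg hU.zero_le N.A
  refine posDef_of_dotProduct_eq_zero (add_nonneg hA N.Q_nonneg) fun x hx =>
    hc.eq_zero_of_invariant (p := fun x => x ⬝ᵥ N.kfStep δ d P *ᵥ x = 0) (fun x hx => ?_) hx
  rw [kfStep, timeUpdate, Matrix.add_mulVec, dotProduct_add] at hx
  have p1 := (nonneg_iff_dotProduct.1 hA).2 x
  have p2 := (nonneg_iff_dotProduct.1 N.Q_nonneg).2 x
  refine ⟨mulVec_eq_zero_of_dotProduct N.Q_nonneg (by linarith), ?_⟩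
  have e1 : x ⬝ᵥ (N.A * N.measUpdate δ d P * N.Aᵀ) *ᵥ x = 0 := by linarith
  rw [dotProduct_conj_mulVec] at e1
  have e2 : N.Aᵀ *ᵥ x = 0 := by
    by_contra hne
    have := hU.dotProduct_mulVec_pos hne
    rw [star_trivial, e1] at this
    exact lt_irrefl _ this
  rw [e2, zero_dotProduct]

theorem kalmanGain_apply (d : ℕ) (P : Matrix (Fin n) (Fin n) ℝ) (i) :
    N.kalmanGain δ d P i = N.measUpdate δ d P * (N.C i)ᵀ * (N.inflatedNoise δ P i)⁻¹ := rfl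

theorem covStep_continuous_uncurry :
    Continuous fun p : (∀ i, Matrix (Fin n) (Fin (m i)) ℝ) × Matrix (Fin n) (Fin n) ℝ =>
      N.covStep δ I p.1 p.2 := by
  change Continuous fun p : (∀ i, Matrix (Fin n) (Fin (m i)) ℝ) × Matrix (Fin n) (Fin n) ℝ =>
    N.A * ((1 - ∑ i ∈ I, N.lam i • (p.1 i * N.C i)) * p.2 *
      (1 - ∑ i ∈ I, N.lam i • (p.1 i * N.C i))ᵀ +
    ∑ i ∈ I, N.lam i • (p.1 i * ((1 - N.lam i) • (N.C i * p.2 * (N.C i)ᵀ) + N.R i (δ i)) *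
      (p.1 i)ᵀ)) * N.Aᵀ + N.Q
  fun_prop

theorem tendsto_covStep {ι : Type*} {f : Filter ι} {Kt : ι → ∀ i, Matrix (Fin n) (Fin (m i)) ℝ}
    {Mt : ι → Matrix (Fin n) (Fin n) ℝ} {K : ∀ i, Matrix (Fin n) (Fin (m i)) ℝ}
    {M : Matrix (Fin n) (Fin n) ℝ} (hK : Tendsto Kt f (𝓝 K)) (hM : Tendsto Mt f (𝓝 M)) :
    Tendsto (fun t => N.covStep δ I (Kt t) (Mt t)) f (𝓝 (N.covStep δ I K M)) := by
  have h1 := (N.covStep_continuous_uncurry δ I).tendsto (K, M)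
  have h2 := hK.prodMk_nhds hM
  have h3 := h1.comp h2
  simp only [Function.comp_def] at h3
  exact h3

variable {δ} in
theorem tendsto_inflatedNoise_inv (hδ : ∀ i, 0 < δ i) {ι : Type*} {f : Filter ι}
    {M : ι → Matrix (Fin n) (Fin n) ℝ} {L : Matrix (Fin n) (Fin n) ℝ} (hL : 0 ≤ L)
    (h : Tendsto M f (𝓝 L)) (i) :
    Tendsto (fun t => (N.inflatedNoise δ (M t) i)⁻¹) f (𝓝 (N.inflatedNoise δ L i)⁻¹) := by
  refine tendsto_matrix_inv (N.inflatedNoise_posDef hδ hL i) ?_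
  have hc : Continuous fun Y : Matrix (Fin n) (Fin n) ℝ => N.inflatedNoise δ Y i := by
    unfold inflatedNoise
    fun_prop
  exact (hc.tendsto L).comp h

variable {δ} in
theorem tendsto_kfStep (hδ : ∀ i, 0 < δ i) (d : ℕ) {ι : Type*} {f : Filter ι}
    {M : ι → Matrix (Fin n) (Fin n) ℝ} {L : Matrix (Fin n) (Fin n) ℝ} (hM : ∀ t, (M t).PosDef)
    (hL : L.PosDef) (h : Tendsto M f (𝓝 L)) :
    Tendsto (fun t => N.kfStep δ d (M t)) f (𝓝 (N.kfStep δ d L)) := by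
  refine (N.timeUpdate_continuous.tendsto _).comp
    (tendsto_matrix_inv (N.posDef_inv_add_dataInfo hδ d hL) ((tendsto_matrix_inv hL h).add ?_))
  simp only [N.dataInfo_eq hδ d (hM _), N.dataInfo_eq hδ d hL]
  refine tendsto_finsetSum _ fun i _ => ?_
  have hc : Continuous fun Y : Matrix (Fin (m i)) (Fin (m i)) ℝ =>
      N.lam i • ((N.C i)ᵀ * Y * N.C i) := by fun_prop
  exact (hc.tendsto _).comp (N.tendsto_inflatedNoise_inv hδ hL.zero_le h i)

variable {N δ K} in
/-- Iterating the Riccati map from a steady state of any constant gains converges to a positive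
definite solution of the ARE. -/
theorem IsControllable.exists_fixed (hc : N.IsControllable) (hδ : ∀ i, 0 < δ i) (d : ℕ)
    {S : Matrix (Fin n) (Fin n) ℝ} (hS : 0 ≤ S)
    (h : N.covStep δ (N.activeSensors δ d) K S = S) :
    ∃ P : Matrix (Fin n) (Fin n) ℝ, P.PosDef ∧ N.kfStep δ d P = P := by
  set I := N.activeSensors δ d
  set P : ℕ → Matrix (Fin n) (Fin n) ℝ := fun t => (N.kfStep δ d)^[t] S with hPdef
  have hsucc : ∀ t, P (t + 1) = N.kfStep δ d (P t) := fun t => Function.iterate_succ_apply' _ _ _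
  have hP : ∀ t, (P t).PosDef := fun t => by
    induction t with
    | zero => exact hc.posDef_of_fixed hδ hS h
    | succ t ih => rw [hsucc]; exact hc.kfStep_posDef hδ d ih
  have hanti : Antitone P := by
    refine antitone_nat_of_succ_le fun t => ?_
    induction t with
    | zero => exact (hsucc 0).trans_le ((N.kfStep_le_covStep K hδ d (hP 0)).trans_eq h)
    | succ t ih =>
      rw [hsucc (t + 1)]
      refine (N.kfStep_mono hδ d (hP _) ih).trans_eq (hsucc t).symm
  obtain ⟨L, hL⟩ := exists_tendsto_of_antitone (fun t => (hP t).zero_le) hanti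
  -- The limit `L` is not yet known to be invertible, so the updated covariances cannot be passed to
  -- the limit by continuity of inversion; monotonicity provides their limit instead. The gains then
  -- converge, since they involve only the inverse of the inflated noise, which stays positive
  -- definite.
  obtain ⟨V, hV⟩ := exists_tendsto_of_antitone (M := fun t => N.measUpdate δ d (P t))
    (fun t => (N.measUpdate_posDef hδ d (hP t)).zero_le)
    (fun t u htu => N.measUpdate_mono hδ d (hP u) (hanti htu))
  have hL0 : 0 ≤ L := nonneg_of_tendsto hL fun t => (hP t).zero_le
  obtain ⟨κ, hκ⟩ : ∃ κ, Tendsto (fun t => N.kalmanGain δ d (P t)) atTop (𝓝 κ) := by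
    refine ⟨fun i => V * (N.C i)ᵀ * (N.inflatedNoise δ L i)⁻¹, tendsto_pi_nhds.2 fun i => ?_⟩
    simp only [kalmanGain_apply]
    have hcont : Continuous fun p : Matrix (Fin n) (Fin n) ℝ × Matrix (Fin (m i)) (Fin (m i)) ℝ =>
      p.1 * (N.C i)ᵀ * p.2 := by fun_prop
    have h1 := (hcont.tendsto (V, (N.inflatedNoise δ L i)⁻¹)).comp
      (hV.prodMk_nhds (N.tendsto_inflatedNoise_inv hδ hL0 hL i))
    exact h1
  -- The Joseph form is polynomial in the gains and the covariance, so the recursion passes to the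
  -- limit even at a singular `L`. Only then does controllability exclude singularity, after which
  -- the Riccati map itself is continuous at `L`.
  have hfix : N.covStep δ I κ L = L := by
    have h1 : Tendsto (fun t => N.covStep δ I (N.kalmanGain δ d (P t)) (P t)) atTop
        (𝓝 (N.covStep δ I κ L)) := N.tendsto_covStep δ I hκ hL
    refine tendsto_nhds_unique h1 ((hL.comp (tendsto_add_atTop_nat 1)).congr fun t => ?_)
    rw [Function.comp_apply, hsucc, N.covStep_kalmanGain hδ d (hP t)]
  have hLpos : L.PosDef := hc.posDef_of_fixed hδ hL0 hfix
  refine ⟨L, hLpos, tendsto_nhds_unique (N.tendsto_kfStep hδ d hP hLpos hL) ?_⟩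
  exact (hL.comp (tendsto_add_atTop_nat 1)).congr fun t => by rw [Function.comp_apply, hsucc]

end ProcessingNetwork

namespace ProcessingNetwork

open scoped MatrixOrder

/-! ### Second moments of random vectors -/

section Moments

variable {Ω : Type*} [MeasurableSpace Ω] {μ : Measure Ω} {p q r : ℕ}

theorem measurable_mulVec {Ω : Type*} {m' : MeasurableSpace Ω} (B : Matrix (Fin q) (Fin p) ℝ)
    {e : Ω → Fin p → ℝ} (he : Measurable e) : Measurable fun ω => B *ᵥ e ω := by
  have h : Continuous fun x : Fin p → ℝ => B *ᵥ x := by fun_prop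
  exact h.measurable.comp he

theorem measurable_coord {Ω : Type*} {m' : MeasurableSpace Ω} {e : Ω → Fin p → ℝ}
    (he : Measurable e) (a : Fin p) : Measurable fun ω => e ω a :=
  (measurable_pi_apply a).comp he

theorem memLp_mulVec (B : Matrix (Fin q) (Fin p) ℝ) {e : Ω → Fin p → ℝ} (he : MemLp e 2 μ) :
    MemLp (fun ω => B *ᵥ e ω) 2 μ := by
  refine memLp_pi_iff.2 fun a => ?_
  simp only [Matrix.mulVec, dotProduct]
  exact memLp_finsetSum _ fun b _ => (he.eval b).const_mul _

theorem memLp_binary_smul {φ : Ω → ℝ} (hφ : Measurable φ) (hb : ∀ ω, φ ω = 0 ∨ φ ω = 1)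
    {e : Ω → Fin p → ℝ} (he : MemLp e 2 μ) : MemLp (fun ω => φ ω • e ω) 2 μ := by
  refine he.mono (hφ.aestronglyMeasurable.smul he.1) (Eventually.of_forall fun ω => ?_)
  rcases hb ω with h | h <;> simp [h]

/-- Matrix of the mixed second moments of two random vectors. -/
noncomputable def crossMoment (μ : Measure Ω) (e : Ω → Fin p → ℝ) (f : Ω → Fin q → ℝ) :
    Matrix (Fin p) (Fin q) ℝ :=
  Matrix.of fun a b => ∫ ω, e ω a * f ω b ∂μ

theorem crossMoment_apply (e : Ω → Fin p → ℝ) (f : Ω → Fin q → ℝ) (a b) :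
    crossMoment μ e f a b = ∫ ω, e ω a * f ω b ∂μ := rfl

theorem crossMoment_transpose (e : Ω → Fin p → ℝ) (f : Ω → Fin q → ℝ) :
    (crossMoment μ e f)ᵀ = crossMoment μ f e := by
  ext a b
  simp only [Matrix.transpose_apply, crossMoment_apply, mul_comm]

variable {e e' : Ω → Fin p → ℝ} {f : Ω → Fin q → ℝ}

theorem integrable_mul_coord (he : MemLp e 2 μ) (hf : MemLp f 2 μ) (a b) :
    Integrable (fun ω => e ω a * f ω b) μ :=
  (he.eval a).integrable_mul (hf.eval b)

theorem crossMoment_add_left (he : MemLp e 2 μ) (he' : MemLp e' 2 μ) (hf : MemLp f 2 μ) :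
    crossMoment μ (fun ω => e ω + e' ω) f = crossMoment μ e f + crossMoment μ e' f := by
  ext a b
  simp only [crossMoment_apply, Matrix.add_apply, Pi.add_apply, add_mul]
  exact integral_add (integrable_mul_coord he hf a b) (integrable_mul_coord he' hf a b)

theorem crossMoment_sub_left (he : MemLp e 2 μ) (he' : MemLp e' 2 μ) (hf : MemLp f 2 μ) :
    crossMoment μ (fun ω => e ω - e' ω) f = crossMoment μ e f - crossMoment μ e' f := by
  ext a b
  simp only [crossMoment_apply, Matrix.sub_apply, Pi.sub_apply, sub_mul]
  exact integral_sub (integrable_mul_coord he hf a b) (integrable_mul_coord he' hf a b)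

theorem crossMoment_sum_left {ι : Type*} (I : Finset ι) {e : ι → Ω → Fin p → ℝ}
    (he : ∀ i, MemLp (e i) 2 μ) (hf : MemLp f 2 μ) :
    crossMoment μ (fun ω => ∑ i ∈ I, e i ω) f = ∑ i ∈ I, crossMoment μ (e i) f := by
  ext a b
  simp only [crossMoment_apply, Matrix.sum_apply, Finset.sum_apply, Finset.sum_mul]
  exact integral_finsetSum _ fun i _ => integrable_mul_coord (he i) hf a b

theorem crossMoment_mulVec_left (B : Matrix (Fin r) (Fin p) ℝ) (he : MemLp e 2 μ)
    (hf : MemLp f 2 μ) :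
    crossMoment μ (fun ω => B *ᵥ e ω) f = B * crossMoment μ e f := by
  ext a b
  simp only [crossMoment_apply, Matrix.mul_apply, Matrix.mulVec, dotProduct, Finset.sum_mul,
    mul_assoc]
  rw [integral_finsetSum _ fun c _ => (integrable_mul_coord he hf c b).const_mul _]
  simp only [integral_const_mul]

variable {f' : Ω → Fin q → ℝ}

theorem crossMoment_add_right (he : MemLp e 2 μ) (hf : MemLp f 2 μ) (hf' : MemLp f' 2 μ) :
    crossMoment μ e (fun ω => f ω + f' ω) = crossMoment μ e f + crossMoment μ e f' := by
  rw [← crossMoment_transpose, crossMoment_add_left hf hf' he, Matrix.transpose_add,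
    crossMoment_transpose, crossMoment_transpose]

theorem crossMoment_sub_right (he : MemLp e 2 μ) (hf : MemLp f 2 μ) (hf' : MemLp f' 2 μ) :
    crossMoment μ e (fun ω => f ω - f' ω) = crossMoment μ e f - crossMoment μ e f' := by
  rw [← crossMoment_transpose, crossMoment_sub_left hf hf' he, Matrix.transpose_sub,
    crossMoment_transpose, crossMoment_transpose]

theorem crossMoment_sum_right {ι : Type*} (I : Finset ι) {f : ι → Ω → Fin q → ℝ}
    (he : MemLp e 2 μ) (hf : ∀ i, MemLp (f i) 2 μ) :
    crossMoment μ e (fun ω => ∑ i ∈ I, f i ω) = ∑ i ∈ I, crossMoment μ e (f i) := by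
  rw [← crossMoment_transpose, crossMoment_sum_left I hf he, Matrix.transpose_sum]
  simp only [crossMoment_transpose]

theorem crossMoment_mulVec_right (B : Matrix (Fin r) (Fin q) ℝ) (he : MemLp e 2 μ)
    (hf : MemLp f 2 μ) :
    crossMoment μ e (fun ω => B *ᵥ f ω) = crossMoment μ e f * Bᵀ := by
  rw [← crossMoment_transpose, crossMoment_mulVec_left B hf he, Matrix.transpose_mul,
    crossMoment_transpose]

theorem crossMoment_self_nonneg (he : MemLp e 2 μ) : 0 ≤ crossMoment μ e e := by
  refine nonneg_iff_dotProduct.2 ⟨crossMoment_transpose e e, fun x => ?_⟩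
  set B : Matrix (Fin 1) (Fin p) ℝ := Matrix.of fun _ a => x a
  have h : (B * crossMoment μ e e * Bᵀ) 0 0 = x ⬝ᵥ crossMoment μ e e *ᵥ x := by
    rw [Matrix.mul_assoc, Matrix.mul_apply]
    rfl
  rw [← h, ← crossMoment_mulVec_left B he he, ← crossMoment_mulVec_right B (memLp_mulVec B he) he,
    crossMoment_apply]
  exact integral_nonneg fun ω => mul_self_nonneg _

variable {S : Matrix (Fin p) (Fin p) ℝ}

theorem measurePreserving_toLp (hem : Measurable e)
    (hlaw : HasLaw (fun ω => WithLp.toLp 2 (e ω)) (multivariateGaussian 0 S) μ) :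
    MeasurePreserving (fun ω => WithLp.toLp 2 (e ω)) μ (multivariateGaussian 0 S) :=
  hlaw.measurePreserving (by fun_prop)

theorem memLp_eval_multivariateGaussian (a : Fin p) :
    MemLp (fun x : EuclideanSpace ℝ (Fin p) => x a) 2 (multivariateGaussian 0 S) := by
  have := (IsGaussian.memLp_two_id (μ := multivariateGaussian (0 : EuclideanSpace ℝ (Fin p)) S))
  exact (EuclideanSpace.proj (𝕜 := ℝ) a).comp_memLp' this

theorem memLp_of_hasLaw (hem : Measurable e)
    (hlaw : HasLaw (fun ω => WithLp.toLp 2 (e ω)) (multivariateGaussian 0 S) μ) :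
    MemLp e 2 μ :=
  memLp_pi_iff.2 fun a =>
    (memLp_eval_multivariateGaussian a).comp_measurePreserving (measurePreserving_toLp hem hlaw)

theorem integral_multivariateGaussian_eval (a : Fin p) :
    ∫ x, x a ∂(multivariateGaussian (0 : EuclideanSpace ℝ (Fin p)) S) = 0 := by
  have h := (EuclideanSpace.proj (𝕜 := ℝ) a).integral_comp_comm
    (IsGaussian.integrable_id (μ := multivariateGaussian (0 : EuclideanSpace ℝ (Fin p)) S))
  simp only [id, integral_id_multivariateGaussian, map_zero] at h
  exact h

theorem integral_of_hasLaw
    (hlaw : HasLaw (fun ω => WithLp.toLp 2 (e ω)) (multivariateGaussian 0 S) μ) (a : Fin p) :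
    ∫ ω, e ω a ∂μ = 0 := by
  rw [← integral_multivariateGaussian_eval (S := S) a]
  exact hlaw.integral_comp (f := fun x : EuclideanSpace ℝ (Fin p) => x a)
    (memLp_eval_multivariateGaussian a).1

/-- Together with square integrability and the vanishing mean, this is all that is used of the
Gaussian laws. -/
theorem crossMoment_of_hasLaw [IsProbabilityMeasure μ] (hem : Measurable e) (hS : S.PosSemidef)
    (hlaw : HasLaw (fun ω => WithLp.toLp 2 (e ω)) (multivariateGaussian 0 S) μ) :
    crossMoment μ e e = S := by
  ext a b
  have hL := memLp_of_hasLaw hem hlaw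
  have h1 := covariance_eq_sub (hL.eval a) (hL.eval b)
  rw [integral_of_hasLaw hlaw, zero_mul, sub_zero] at h1
  rw [← covariance_eval_multivariateGaussian (μ := 0) hS a b]
  refine h1.symm.trans ?_
  exact hlaw.covariance_comp (f := fun x : EuclideanSpace ℝ (Fin p) => x a)
    (g := fun x : EuclideanSpace ℝ (Fin p) => x b)
    (memLp_eval_multivariateGaussian a).1.aemeasurable
    (memLp_eval_multivariateGaussian b).1.aemeasurable

end Moments

end ProcessingNetwork

namespace ProcessingNetwork

open scoped MatrixOrder

namespace Realization

variable {n s : ℕ} {m : Fin (s + 1) → ℕ} {N : ProcessingNetwork n s m} {δ : Fin (s + 1) → ℕ}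
  {Ω : Type*} [mΩ : MeasurableSpace Ω] {μ : Measure Ω} (X : Realization N δ μ)

/-! ### Independence of the sources -/

/-- The σ-algebra of a source of randomness. -/
@[reducible] def sourceAlg : NoiseSource s → MeasurableSpace Ω
  | .initial => MeasurableSpace.comap X.x0 inferInstance
  | .system k => MeasurableSpace.comap (X.w k) inferInstance
  | .sensor k i => MeasurableSpace.comap (X.v k i) inferInstance
  | .arrival k => ⨆ i, MeasurableSpace.comap (X.γ k i) inferInstance

/-- The σ-algebra of a set of sources of randomness. -/
@[reducible] def sourcesAlg (S : Set (NoiseSource s)) : MeasurableSpace Ω :=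
  ⨆ a ∈ S, X.sourceAlg a

theorem sourceAlg_le (a : NoiseSource s) : X.sourceAlg a ≤ mΩ := by
  cases a with
  | initial => exact X.x0_measurable.comap_le
  | system k => exact (X.w_measurable k).comap_le
  | sensor k i => exact (X.v_measurable k i).comap_le
  | arrival k => exact iSup_le fun i => (X.γ_measurable k i).comap_le

theorem sourcesAlg_le (S : Set (NoiseSource s)) : X.sourcesAlg S ≤ mΩ :=
  iSup₂_le fun a _ => X.sourceAlg_le a

theorem sourcesAlg_mono {S T : Set (NoiseSource s)} (h : S ⊆ T) :
    X.sourcesAlg S ≤ X.sourcesAlg T :=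
  biSup_mono h

theorem indep_sourcesAlg {S T : Set (NoiseSource s)} (h : Disjoint S T) :
    Indep (X.sourcesAlg S) (X.sourcesAlg T) μ :=
  indep_iSup_of_disjoint X.sourceAlg_le X.indep h

theorem sourceAlg_le_sourcesAlg {S : Set (NoiseSource s)} {a : NoiseSource s} (ha : a ∈ S) :
    X.sourceAlg a ≤ X.sourcesAlg S :=
  le_iSup₂_of_le a ha le_rfl

theorem measurable_x0 {S : Set (NoiseSource s)} (h : NoiseSource.initial ∈ S) :
    Measurable[X.sourcesAlg S] X.x0 :=
  measurable_iff_comap_le.2 (X.sourceAlg_le_sourcesAlg h)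

theorem measurable_w {S : Set (NoiseSource s)} {k : ℕ} (h : NoiseSource.system k ∈ S) :
    Measurable[X.sourcesAlg S] (X.w k) :=
  measurable_iff_comap_le.2 (X.sourceAlg_le_sourcesAlg h)

theorem measurable_v {S : Set (NoiseSource s)} {k : ℕ} {i} (h : NoiseSource.sensor k i ∈ S) :
    Measurable[X.sourcesAlg S] (X.v k i) :=
  measurable_iff_comap_le.2 (X.sourceAlg_le_sourcesAlg h)

theorem measurable_γ {S : Set (NoiseSource s)} {k : ℕ} (h : NoiseSource.arrival k ∈ S) (i) :
    Measurable[X.sourcesAlg S] (X.γ k i) :=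
  measurable_iff_comap_le.2 ((le_iSup
    (fun i => MeasurableSpace.comap (X.γ k i) (inferInstance : MeasurableSpace ℝ)) i).trans
      (X.sourceAlg_le_sourcesAlg h))

theorem integral_mul_of_disjoint {S T : Set (NoiseSource s)} (h : Disjoint S T) {f g : Ω → ℝ}
    (hf : Measurable[X.sourcesAlg S] f) (hg : Measurable[X.sourcesAlg T] g) :
    ∫ ω, f ω * g ω ∂μ = (∫ ω, f ω ∂μ) * ∫ ω, g ω ∂μ := by
  have hind : IndepFun f g μ := (IndepFun_iff_Indep f g μ).2
    (indep_of_indep_of_le_left (indep_of_indep_of_le_right (X.indep_sourcesAlg h)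
      (measurable_iff_comap_le.1 hg)) (measurable_iff_comap_le.1 hf))
  exact hind.integral_fun_mul_eq_mul_integral
    (hf.mono (X.sourcesAlg_le S) le_rfl).aestronglyMeasurable
    (hg.mono (X.sourcesAlg_le T) le_rfl).aestronglyMeasurable

variable {p q : ℕ}

theorem crossMoment_eq_zero {S T : Set (NoiseSource s)} (h : Disjoint S T)
    {e : Ω → Fin p → ℝ} {f : Ω → Fin q → ℝ} (he : Measurable[X.sourcesAlg S] e)
    (hf : Measurable[X.sourcesAlg T] f) (hf0 : ∀ b, ∫ ω, f ω b ∂μ = 0) :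
    crossMoment μ e f = 0 := by
  ext a b
  rw [crossMoment_apply, X.integral_mul_of_disjoint h (measurable_coord he a)
    (measurable_coord hf b), hf0, mul_zero, Matrix.zero_apply]

/-- The scalars will be arrivals and the vectors innovations: by independence, random reception
enters the second moments only through the moments of the arrivals. -/
theorem crossMoment_smul_smul {S T : Set (NoiseSource s)} (h : Disjoint S T)
    {φ ψ : Ω → ℝ} {e : Ω → Fin p → ℝ} {f : Ω → Fin q → ℝ} (hφ : Measurable[X.sourcesAlg S] φ)
    (hψ : Measurable[X.sourcesAlg S] ψ) (he : Measurable[X.sourcesAlg T] e)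
    (hf : Measurable[X.sourcesAlg T] f) :
    crossMoment μ (fun ω => φ ω • e ω) (fun ω => ψ ω • f ω) =
      (∫ ω, φ ω * ψ ω ∂μ) • crossMoment μ e f := by
  ext a b
  rw [Matrix.smul_apply, smul_eq_mul, crossMoment_apply, crossMoment_apply,
    ← X.integral_mul_of_disjoint h (f := fun ω => φ ω * ψ ω) (g := fun ω => e ω a * f ω b)
      (hφ.mul hψ) ((measurable_coord he a).mul (measurable_coord hf b))]
  refine integral_congr_ae (Eventually.of_forall fun ω => ?_)
  simp only [Pi.smul_apply, smul_eq_mul]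
  ring

/-! ### Moments of the arrivals -/

theorem γ_sq (k i ω) : X.γ k i ω * X.γ k i ω = X.γ k i ω := by
  rcases X.γ_binary k i ω with h | h <;> simp [h]

theorem integral_γ (k i) : ∫ ω, X.γ k i ω ∂μ = N.lam i := by
  have hs : MeasurableSet {ω | X.γ k i ω = 1} := X.γ_measurable k i (measurableSet_singleton 1)
  rw [← X.γ_prob k i, ← integral_indicator_one hs]
  refine integral_congr_ae (Eventually.of_forall fun ω => ?_)
  rcases X.γ_binary k i ω with h | h <;> simp [Set.indicator, h]

theorem memLp_γ [IsProbabilityMeasure μ] (k i) : MemLp (X.γ k i) 2 μ := by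
  refine MemLp.of_bound (X.γ_measurable k i).aestronglyMeasurable 1
    (Eventually.of_forall fun ω => ?_)
  rcases X.γ_binary k i ω with h | h <;> simp [h]

theorem integral_γ_mul_self (k i) : ∫ ω, X.γ k i ω * X.γ k i ω ∂μ = N.lam i := by
  simp only [X.γ_sq, X.integral_γ]

theorem integral_γ_mul [IsProbabilityMeasure μ] (k) {i j} (hij : i ≠ j) :
    ∫ ω, X.γ k i ω * X.γ k j ω ∂μ = N.lam i * N.lam j := by
  have h := covariance_eq_sub (X.memLp_γ k i) (X.memLp_γ k j)
  rw [X.γ_uncorrelated k i j hij, X.integral_γ, X.integral_γ] at h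
  simp only [Pi.mul_apply] at h
  linarith

/-! ### Error dynamics -/

/-- The prediction error of the filter with gains `g`, started from the estimate `c`. -/
def errorRun (g : ℕ → ∀ i, Matrix (Fin n) (Fin (m i)) ℝ) (c : Fin n → ℝ) : ℕ → Ω → Fin n → ℝ
  | 0, ω => X.x0 ω - c
  | t + 1, ω => N.A *ᵥ (errorRun g c t ω -
      ∑ i, X.γ t i ω • (g t i *ᵥ (N.C i *ᵥ errorRun g c t ω + X.v t i ω))) + X.w t ω

theorem state_sub_filterRun (g : ℕ → ∀ i, Matrix (Fin n) (Fin (m i)) ℝ) (c : Fin n → ℝ) (t : ℕ)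
    (ω : Ω) : X.state t ω - X.filterRun g c t ω = X.errorRun g c t ω := by
  induction t with
  | zero => rfl
  | succ t ih =>
    have h : ∀ i, X.meas t i ω - N.C i *ᵥ X.filterRun g c t ω =
        N.C i *ᵥ X.errorRun g c t ω + X.v t i ω := fun i => by
      rw [← ih, Matrix.mulVec_sub, meas]
      abel
    simp only [state, filterRun, errorRun, h]
    rw [← ih]
    simp only [Matrix.mulVec_sub, Matrix.mulVec_add]
    abel

/-- The sources of randomness that act before time `t`. -/
def sourcesBefore (t : ℕ) : Set (NoiseSource s) :=
  {a | match a with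
    | .initial => True
    | .system k => k < t
    | .sensor k _ => k < t
    | .arrival k => k < t}

theorem measurable_errorRun_step {Ω : Type*} {m' : MeasurableSpace Ω}
    (g : ∀ i, Matrix (Fin n) (Fin (m i)) ℝ)
    {e w : Ω → Fin n → ℝ} {φ : Fin (s + 1) → Ω → ℝ} {v : ∀ i, Ω → Fin (m i) → ℝ}
    (he : Measurable e) (hw : Measurable w) (hφ : ∀ i, Measurable (φ i))
    (hv : ∀ i, Measurable (v i)) :
    Measurable fun ω =>
      N.A *ᵥ (e ω - ∑ i, φ i ω • (g i *ᵥ (N.C i *ᵥ e ω + v i ω))) + w ω :=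
  (measurable_mulVec _ (he.sub (Finset.measurable_fun_sum _ fun i _ =>
    (hφ i).smul (measurable_mulVec _ ((measurable_mulVec _ he).add (hv i)))))).add hw

variable (g : ℕ → ∀ i, Matrix (Fin n) (Fin (m i)) ℝ) (c : Fin n → ℝ)

/-- This makes the error at time `t` independent of the noises and arrivals of time `t`. -/
theorem measurable_errorRun (t : ℕ) :
    Measurable[X.sourcesAlg (sourcesBefore t)] (X.errorRun g c t) := by
  induction t with
  | zero => exact (X.measurable_x0 (S := sourcesBefore 0) trivial).sub measurable_const
  | succ t ih =>
    have hsub : sourcesBefore (s := s) t ⊆ sourcesBefore (t + 1) := by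
      rintro (_ | k | ⟨k, i⟩ | k) h
      · trivial
      all_goals exact Nat.lt_succ_of_lt h
    refine measurable_errorRun_step _ (ih.mono (X.sourcesAlg_mono hsub) le_rfl)
      (X.measurable_w (S := sourcesBefore (t + 1)) (Nat.lt_succ_self t))
      (fun i => X.measurable_γ (S := sourcesBefore (t + 1)) (Nat.lt_succ_self t) i)
      (fun i => X.measurable_v (S := sourcesBefore (t + 1)) (Nat.lt_succ_self t))

theorem memLp_w (k) : MemLp (X.w k) 2 μ := memLp_of_hasLaw (X.w_measurable k) (X.w_law k)

theorem memLp_v (k i) : MemLp (X.v k i) 2 μ := memLp_of_hasLaw (X.v_measurable k i) (X.v_law k i)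

theorem memLp_errorRun [IsProbabilityMeasure μ] (t : ℕ) : MemLp (X.errorRun g c t) 2 μ := by
  induction t with
  | zero => exact X.x0_memLp.sub (memLp_const c)
  | succ t ih =>
    exact (memLp_mulVec _ (ih.sub (memLp_finsetSum _ fun i _ =>
      memLp_binary_smul (X.γ_measurable t i) (X.γ_binary t i)
        (memLp_mulVec _ ((memLp_mulVec _ ih).add (X.memLp_v t i)))))).add (X.memLp_w t)

/-- The double sum has the shape of the cross moments of the received corrections: all pairs carry
`λᵢ λⱼ`, and the diagonal carries the excess `λ - λ² = λ (1 - λ)` together with the sensor noise. -/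
theorem josephUpdate_expand (K : ∀ i, Matrix (Fin n) (Fin (m i)) ℝ) {M : Matrix (Fin n) (Fin n) ℝ}
    (hM : Mᵀ = M) :
    N.josephUpdate δ Finset.univ K M =
      M - ∑ i, N.lam i • (M * (K i * N.C i)ᵀ) - ∑ i, N.lam i • (M * (K i * N.C i)ᵀ)ᵀ +
        ∑ i, ∑ j, ((N.lam i * N.lam j) • ((K i * N.C i) * M * (K j * N.C j)ᵀ) +
          if i = j then (N.lam i * (1 - N.lam i)) • ((K i * N.C i) * M * (K i * N.C i)ᵀ) +
            N.lam i • (K i * N.R i (δ i) * (K i)ᵀ) else 0) := by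
  have h1 : ∑ i, ∑ j, (N.lam i * N.lam j) • ((K i * N.C i) * M * (K j * N.C j)ᵀ) =
      (∑ i, N.lam i • (K i * N.C i)) * M * (∑ i, N.lam i • (K i * N.C i))ᵀ := by
    rw [Matrix.transpose_sum, Matrix.sum_mul, Matrix.sum_mul]
    refine Finset.sum_congr rfl fun i _ => ?_
    rw [Matrix.mul_sum]
    refine Finset.sum_congr rfl fun j _ => ?_
    rw [Matrix.transpose_smul, Matrix.mul_smul, Matrix.smul_mul, Matrix.smul_mul, smul_smul,
      mul_comm]
  have h2 : ∑ i, N.lam i • (M * (K i * N.C i)ᵀ) = M * (∑ i, N.lam i • (K i * N.C i))ᵀ := by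
    simp only [Matrix.transpose_sum, Matrix.mul_sum, Matrix.mul_smul, Matrix.transpose_smul]
  have h3 : ∑ i, N.lam i • (M * (K i * N.C i)ᵀ)ᵀ = (∑ i, N.lam i • (K i * N.C i)) * M := by
    simp only [Matrix.transpose_mul, Matrix.transpose_transpose, hM, Matrix.sum_mul,
      Matrix.smul_mul]
  have h4 : ∀ i, N.lam i • (K i * N.inflatedNoise δ M i * (K i)ᵀ) =
      (N.lam i * (1 - N.lam i)) • ((K i * N.C i) * M * (K i * N.C i)ᵀ) +
        N.lam i • (K i * N.R i (δ i) * (K i)ᵀ) := fun i => by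
    simp only [inflatedNoise, Matrix.mul_add, Matrix.add_mul, smul_add, Matrix.mul_smul,
      Matrix.smul_mul, smul_smul, Matrix.transpose_mul, Matrix.mul_assoc]
  simp only [Finset.sum_add_distrib, Finset.sum_ite_eq, Finset.mem_univ, if_true]
  rw [h1, h2, h3, josephUpdate, meanResidual, ← Finset.sum_add_distrib]
  simp only [h4, Matrix.transpose_sub, Matrix.transpose_one, Matrix.mul_sub, Matrix.sub_mul,
    Matrix.mul_one, Matrix.one_mul]
  abel

/-- The second moments of the prediction error follow the Joseph form of the Riccati recursion. -/
theorem crossMoment_errorRun_succ [IsProbabilityMeasure μ] (hδ : ∀ i, 0 < δ i) (t : ℕ) :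
    crossMoment μ (X.errorRun g c (t + 1)) (X.errorRun g c (t + 1)) =
      N.covStep δ Finset.univ (g t) (crossMoment μ (X.errorRun g c t) (X.errorRun g c t)) := by
  set e := X.errorRun g c t with he
  set M := crossMoment μ e e with hM
  have heL : MemLp e 2 μ := X.memLp_errorRun g c t
  have hem : Measurable[X.sourcesAlg (sourcesBefore t)] e := X.measurable_errorRun g c t
  have hw0 : ∀ b, ∫ ω, X.w t ω b ∂μ = 0 := integral_of_hasLaw (X.w_law t)
  have hv0 : ∀ i b, ∫ ω, X.v t i ω b ∂μ = 0 := fun i => integral_of_hasLaw (X.v_law t i)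
  set h : Fin (s + 1) → Ω → Fin n → ℝ := fun i ω => g t i *ᵥ (N.C i *ᵥ e ω + X.v t i ω) with hh
  have hCL : ∀ i, MemLp (fun ω => N.C i *ᵥ e ω) 2 μ := fun i => memLp_mulVec _ heL
  have hinL : ∀ i, MemLp (fun ω => N.C i *ᵥ e ω + X.v t i ω) 2 μ := fun i =>
    (hCL i).add (X.memLp_v t i)
  have hhL : ∀ i, MemLp (h i) 2 μ := fun i => memLp_mulVec _ (hinL i)
  have hev : ∀ i, crossMoment μ e (X.v t i) = 0 := fun i =>
    X.crossMoment_eq_zero (S := sourcesBefore t) (T := {NoiseSource.sensor t i})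
      (by simp [sourcesBefore]) hem (X.measurable_v (Set.mem_singleton _)) (hv0 i)
  have hve : ∀ i, crossMoment μ (X.v t i) e = 0 := fun i => by
    rw [← crossMoment_transpose, hev, Matrix.transpose_zero]
  have hvv : ∀ i j, i ≠ j → crossMoment μ (X.v t i) (X.v t j) = 0 := fun i j hij =>
    X.crossMoment_eq_zero (S := {NoiseSource.sensor t i}) (T := {NoiseSource.sensor t j})
      (by simpa using hij) (X.measurable_v (Set.mem_singleton _)) (X.measurable_v (Set.mem_singleton _)) (hv0 j)
  have heh : ∀ i, crossMoment μ e (h i) = M * (g t i * N.C i)ᵀ := fun i => by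
    rw [hh, crossMoment_mulVec_right _ heL (hinL i), crossMoment_add_right heL (hCL i)
      (X.memLp_v t i), hev, add_zero, crossMoment_mulVec_right _ heL heL, Matrix.transpose_mul,
      Matrix.mul_assoc]
  have hhh : ∀ i j, crossMoment μ (h i) (h j) =
      (g t i * N.C i) * M * (g t j * N.C j)ᵀ +
        g t i * crossMoment μ (X.v t i) (X.v t j) * (g t j)ᵀ := fun i j => by
    rw [hh, crossMoment_mulVec_left _ (hinL i) (memLp_mulVec _ (hinL j)),
      crossMoment_mulVec_right _ (hinL i) (hinL j),
      crossMoment_add_left (hCL i) (X.memLp_v t i) (hinL j),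
      crossMoment_add_right (hCL i) (hCL j) (X.memLp_v t j),
      crossMoment_add_right (X.memLp_v t i) (hCL j) (X.memLp_v t j),
      crossMoment_mulVec_left _ heL (hCL j), crossMoment_mulVec_left _ heL (X.memLp_v t j),
      crossMoment_mulVec_right _ heL heL, crossMoment_mulVec_right _ (X.memLp_v t i) heL, hev, hve,
      Matrix.mul_zero, Matrix.zero_mul, add_zero, zero_add]
    simp only [Matrix.mul_add, Matrix.add_mul, Matrix.transpose_mul, Matrix.mul_assoc, hM]
  -- The corrections involve the past and the sensor noises of time `t`, hence every source may be
  -- allowed except the arrivals of that time.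
  have hdisj : Disjoint {NoiseSource.arrival t} ({NoiseSource.arrival t}ᶜ : Set (NoiseSource s)) :=
    disjoint_compl_right
  have hem' : Measurable[X.sourcesAlg {NoiseSource.arrival t}ᶜ] e :=
    hem.mono (X.sourcesAlg_mono (by
      rintro a ha rfl
      exact lt_irrefl t ha)) le_rfl
  have hhm : ∀ i, Measurable[X.sourcesAlg {NoiseSource.arrival t}ᶜ] (h i) := fun i =>
    measurable_mulVec _ ((measurable_mulVec _ hem').add
      (X.measurable_v (S := {NoiseSource.arrival t}ᶜ) (by simp)))
  have hγm : ∀ i, Measurable[X.sourcesAlg {NoiseSource.arrival t}] (X.γ t i) := fun i =>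
    X.measurable_γ (Set.mem_singleton _) i
  set u : Fin (s + 1) → Ω → Fin n → ℝ := fun i ω => X.γ t i ω • h i ω with hu
  have huL : ∀ i, MemLp (u i) 2 μ := fun i =>
    memLp_binary_smul (X.γ_measurable t i) (X.γ_binary t i) (hhL i)
  have heu : ∀ i, crossMoment μ e (u i) = N.lam i • (M * (g t i * N.C i)ᵀ) := fun i => by
    have h1 := X.crossMoment_smul_smul hdisj (φ := fun _ => 1) (ψ := X.γ t i) (e := e) (f := h i)
      measurable_const (hγm i) hem' (hhm i)
    simp only [one_smul, one_mul, X.integral_γ, heh] at h1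
    exact h1
  have huu : ∀ i j, crossMoment μ (u i) (u j) =
      (N.lam i * N.lam j) • ((g t i * N.C i) * M * (g t j * N.C j)ᵀ) +
          if i = j then (N.lam i * (1 - N.lam i)) • ((g t i * N.C i) * M * (g t i * N.C i)ᵀ) +
            N.lam i • (g t i * N.R i (δ i) * (g t i)ᵀ) else 0 := fun i j => by
    rw [hu, X.crossMoment_smul_smul hdisj (hγm i) (hγm j) (hhm i) (hhm j), hhh]
    split_ifs with hij
    · subst hij
      rw [X.integral_γ_mul_self, crossMoment_of_hasLaw (X.v_measurable t i)
        (N.R_posDef' hδ i).posSemidef (X.v_law t i), smul_add, ← add_assoc, ← add_smul]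
      congr 2
      ring
    · rw [X.integral_γ_mul t hij, hvv i j hij, Matrix.mul_zero, Matrix.zero_mul, add_zero, add_zero]
  set y : Ω → Fin n → ℝ := fun ω => e ω - ∑ i, u i ω with hy
  have hsL : MemLp (fun ω => ∑ i, u i ω) 2 μ := memLp_finsetSum _ fun i _ => huL i
  have hyL : MemLp y 2 μ := heL.sub hsL
  have hyy : crossMoment μ y y = N.josephUpdate δ Finset.univ (g t) M := by
    rw [josephUpdate_expand _ (crossMoment_transpose e e), hy,
      crossMoment_sub_left heL hsL hyL, crossMoment_sub_right heL heL hsL,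
      crossMoment_sub_right hsL heL hsL, crossMoment_sum_right _ heL huL,
      crossMoment_sum_left _ huL heL, crossMoment_sum_left _ huL hsL]
    simp only [crossMoment_sum_right _ (huL _) huL, huu]
    have h2 : ∀ i, crossMoment μ (u i) e = N.lam i • (M * (g t i * N.C i)ᵀ)ᵀ := fun i => by
      rw [← crossMoment_transpose, heu, Matrix.transpose_smul]
    simp only [heu, h2, ← hM]
    abel
  have hym : Measurable[X.sourcesAlg {NoiseSource.system t}ᶜ] y := by
    have h1 : Measurable[X.sourcesAlg {NoiseSource.system t}ᶜ] e :=
      hem.mono (X.sourcesAlg_mono (by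
        rintro a ha rfl
        exact lt_irrefl t ha)) le_rfl
    exact h1.sub (Finset.measurable_fun_sum _ fun i _ =>
      (X.measurable_γ (S := {NoiseSource.system t}ᶜ) (by simp) i).smul
        (measurable_mulVec _ ((measurable_mulVec _ h1).add
          (X.measurable_v (S := {NoiseSource.system t}ᶜ) (by simp)))))
  have hyw : crossMoment μ y (X.w t) = 0 :=
    X.crossMoment_eq_zero (S := {NoiseSource.system t}ᶜ) (T := {NoiseSource.system t})
      disjoint_compl_left hym (X.measurable_w (Set.mem_singleton _)) hw0
  have hwy : crossMoment μ (X.w t) y = 0 := by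
    rw [← crossMoment_transpose, hyw, Matrix.transpose_zero]
  have hAyL : MemLp (fun ω => N.A *ᵥ y ω) 2 μ := memLp_mulVec _ hyL
  have hwL := X.memLp_w t
  have hsucc : X.errorRun g c (t + 1) = fun ω => N.A *ᵥ y ω + X.w t ω := rfl
  have hsumL : MemLp (fun ω => N.A *ᵥ y ω + X.w t ω) 2 μ := hAyL.add hwL
  rw [hsucc, crossMoment_add_left hAyL hwL hsumL, crossMoment_add_right hAyL hAyL hwL,
    crossMoment_add_right hwL hAyL hwL, crossMoment_mulVec_left _ hyL hAyL,
    crossMoment_mulVec_left _ hyL hwL, crossMoment_mulVec_right _ hyL hyL,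
    crossMoment_mulVec_right _ hwL hyL, hyw, hwy, Matrix.mul_zero, Matrix.zero_mul, add_zero,
    zero_add, crossMoment_of_hasLaw (X.w_measurable t) N.Q_posSemidef (X.w_law t), hyy, covStep,
    timeUpdate, Matrix.mul_assoc]

end Realization

end ProcessingNetwork

namespace ProcessingNetwork

open scoped MatrixOrder

namespace Realization

variable {n s : ℕ} {m : Fin (s + 1) → ℕ} {N : ProcessingNetwork n s m} {δ : Fin (s + 1) → ℕ}
  {Ω : Type*} [mΩ : MeasurableSpace Ω] {μ : Measure Ω} (X : Realization N δ μ)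

/-! ### Conditioning on the arrivals -/

theorem arrivals_le_sourcesAlg : X.arrivals ≤ X.sourcesAlg (Set.range NoiseSource.arrival) :=
  iSup₂_le fun k i => measurable_iff_comap_le.1
    (X.measurable_γ (S := Set.range NoiseSource.arrival) ⟨k, rfl⟩ i)

theorem arrivals_le : X.arrivals ≤ mΩ := X.arrivals_le_sourcesAlg.trans (X.sourcesAlg_le _)

theorem measurable_γ_arrivals (k i) : Measurable[X.arrivals] (X.γ k i) :=
  measurable_iff_comap_le.2 (le_iSup₂_of_le
    (f := fun k i => MeasurableSpace.comap (X.γ k i) (inferInstance : MeasurableSpace ℝ))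
    k i le_rfl)

/-- An integrable random variable whose mean given the arrivals is zero. -/
def IsCentered (f : Ω → ℝ) : Prop := Integrable f μ ∧ μ[f | X.arrivals] =ᵐ[μ] 0

variable {X} {f f' : Ω → ℝ}

theorem isCentered_zero : X.IsCentered fun _ => 0 :=
  ⟨integrable_zero _ _ _, Eventually.of_forall fun ω => congrFun condExp_zero ω⟩

theorem IsCentered.add (hf : X.IsCentered f) (hf' : X.IsCentered f') :
    X.IsCentered fun ω => f ω + f' ω := by
  refine ⟨hf.1.add hf'.1, (condExp_add hf.1 hf'.1 _).trans ?_⟩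
  filter_upwards [hf.2, hf'.2] with ω h h'
  simp [h, h']

theorem IsCentered.const_mul (hf : X.IsCentered f) (c : ℝ) :
    X.IsCentered fun ω => c * f ω := by
  refine ⟨hf.1.const_mul c, (condExp_smul c f X.arrivals).trans ?_⟩
  filter_upwards [hf.2] with ω h
  simp [h]

theorem IsCentered.sub (hf : X.IsCentered f) (hf' : X.IsCentered f') :
    X.IsCentered fun ω => f ω - f' ω := by
  simpa [sub_eq_add_neg] using hf.add (hf'.const_mul (-1))

theorem IsCentered.sum {ι : Type*} (I : Finset ι) {f : ι → Ω → ℝ}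
    (hf : ∀ i, X.IsCentered (f i)) : X.IsCentered fun ω => ∑ i ∈ I, f i ω := by
  classical
  induction I using Finset.induction_on with
  | empty => simpa using isCentered_zero
  | insert i I hi ih =>
    simp only [Finset.sum_insert hi]
    exact (hf i).add ih

theorem IsCentered.arrival_mul [IsProbabilityMeasure μ] (hf : X.IsCentered f) (k i) :
    X.IsCentered fun ω => X.γ k i ω * f ω := by
  have hb : ∀ ω, ‖X.γ k i ω‖ ≤ 1 := fun ω => by
    rcases X.γ_binary k i ω with h | h <;> simp [h]
  refine ⟨hf.1.bdd_mul (X.γ_measurable k i).aestronglyMeasurable (Eventually.of_forall hb), ?_⟩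
  refine (condExp_stronglyMeasurable_mul_of_bound X.arrivals_le
    (X.measurable_γ_arrivals k i).stronglyMeasurable hf.1 1 (Eventually.of_forall hb)).trans ?_
  filter_upwards [hf.2] with ω h
  simp [h]

theorem IsCentered.mulVec {p q : ℕ} (B : Matrix (Fin q) (Fin p) ℝ) {e : Ω → Fin p → ℝ}
    (he : ∀ a, X.IsCentered fun ω => e ω a) (b) : X.IsCentered fun ω => (B *ᵥ e ω) b :=
  IsCentered.sum Finset.univ (f := fun a ω => B b a * e ω a) fun a => (he a).const_mul _

theorem isCentered_of_disjoint [IsProbabilityMeasure μ] {S : Set (NoiseSource s)}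
    (hS : Disjoint S (Set.range NoiseSource.arrival)) (hf : Measurable[X.sourcesAlg S] f)
    (hfi : Integrable f μ) (h0 : ∫ ω, f ω ∂μ = 0) : X.IsCentered f := by
  refine ⟨hfi, (condExp_indep_eq (X.sourcesAlg_le S) X.arrivals_le hf.stronglyMeasurable
    (indep_of_indep_of_le_right (X.indep_sourcesAlg hS) X.arrivals_le_sourcesAlg)).trans ?_⟩
  exact Eventually.of_forall fun ω => h0

variable (X)

/-- Mean of the initial state. -/
noncomputable def initialMean : Fin n → ℝ := fun a => ∫ ω, X.x0 ω a ∂μ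

/-- Started from the true mean, the error stays centered given the arrivals: the noises are centered
and independent of the arrivals, and a factor `γ` is measurable with respect to them. -/
theorem isCentered_errorRun [IsProbabilityMeasure μ]
    (g : ℕ → ∀ i, Matrix (Fin n) (Fin (m i)) ℝ) (t : ℕ) (a) :
    X.IsCentered fun ω => X.errorRun g X.initialMean t ω a := by
  induction t generalizing a with
  | zero =>
    have hint : Integrable (fun ω => X.x0 ω a) μ := (X.x0_memLp.eval a).integrable one_le_two
    refine isCentered_of_disjoint (S := {NoiseSource.initial}) (by simp)
      ((measurable_coord (X.measurable_x0 (Set.mem_singleton _)) a).sub measurable_const)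
      (hint.sub (integrable_const _)) ?_
    exact (integral_sub hint (integrable_const _)).trans (by simp [initialMean])
  | succ t ih =>
    have hw : ∀ a, X.IsCentered fun ω => X.w t ω a := fun a =>
      isCentered_of_disjoint (S := {NoiseSource.system t}) (by simp)
        (measurable_coord (X.measurable_w (Set.mem_singleton _)) a)
        (((X.memLp_w t).eval a).integrable one_le_two) (integral_of_hasLaw (X.w_law t) a)
    have hv : ∀ i a, X.IsCentered fun ω => X.v t i ω a := fun i a =>
      isCentered_of_disjoint (S := {NoiseSource.sensor t i}) (by simp)
        (measurable_coord (X.measurable_v (Set.mem_singleton _)) a)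
        (((X.memLp_v t i).eval a).integrable one_le_two) (integral_of_hasLaw (X.v_law t i) a)
    refine IsCentered.add (IsCentered.mulVec _ (fun b => IsCentered.sub (ih b) ?_) a) (hw a)
    simp only [Finset.sum_apply]
    exact IsCentered.sum _ fun i => (IsCentered.mulVec _ (fun d =>
      (IsCentered.mulVec _ ih d).add (hv i d)) b).arrival_mul t i

/-- Propagation of an error `h` of the initial estimate. -/
def biasRun (g : ℕ → ∀ i, Matrix (Fin n) (Fin (m i)) ℝ) (h : Fin n → ℝ) : ℕ → Ω → Fin n → ℝ
  | 0, _ => h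
  | t + 1, ω => N.A *ᵥ (biasRun g h t ω -
      ∑ i, X.γ t i ω • (g t i *ᵥ (N.C i *ᵥ biasRun g h t ω)))

variable (g : ℕ → ∀ i, Matrix (Fin n) (Fin (m i)) ℝ) (c c' : Fin n → ℝ)

/-- The error recursion is affine, and the noise cancels between two runs with the same gains and
different initial estimates. -/
theorem errorRun_eq_add_biasRun (t : ℕ) (ω : Ω) :
    X.errorRun g c t ω = X.errorRun g c' t ω + X.biasRun g (c' - c) t ω := by
  induction t with
  | zero => simp [errorRun, biasRun]
  | succ t ih =>
    simp only [errorRun, biasRun, ih, Matrix.mulVec_add, Matrix.mulVec_sub, smul_add,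
      Finset.sum_add_distrib]
    abel

theorem measurable_biasRun (t : ℕ) : Measurable[X.arrivals] (X.biasRun g c t) := by
  induction t with
  | zero => exact measurable_const
  | succ t ih =>
    exact measurable_mulVec _ (ih.sub (Finset.measurable_fun_sum _ fun i _ =>
      (X.measurable_γ_arrivals t i).smul (measurable_mulVec _ (measurable_mulVec _ ih))))

/-- The bias is a function of the arrivals alone, and the remainder is centered given them. -/
theorem condExp_errorRun [IsProbabilityMeasure μ] (t : ℕ) (a) :
    μ[fun ω => X.errorRun g c t ω a | X.arrivals] =ᵐ[μ]
      fun ω => X.biasRun g (X.initialMean - c) t ω a := by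
  have hc := X.isCentered_errorRun g t a
  have hbi : Integrable (fun ω => X.biasRun g (X.initialMean - c) t ω a) μ := by
    refine ((((X.memLp_errorRun g c t).eval a).integrable one_le_two).sub hc.1).congr
      (Eventually.of_forall fun ω => ?_)
    simp [X.errorRun_eq_add_biasRun g c X.initialMean]
  have hbm : StronglyMeasurable[X.arrivals] fun ω => X.biasRun g (X.initialMean - c) t ω a :=
    (measurable_coord (X.measurable_biasRun g _ t) a).stronglyMeasurable
  have hfun : (fun ω => X.errorRun g c t ω a) =
      (fun ω => X.errorRun g X.initialMean t ω a) +
        fun ω => X.biasRun g (X.initialMean - c) t ω a := by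
    funext ω
    simp [X.errorRun_eq_add_biasRun g c X.initialMean t ω]
  rw [hfun]
  refine (condExp_add hc.1 hbi _).trans ?_
  rw [condExp_of_stronglyMeasurable X.arrivals_le hbm hbi]
  filter_upwards [hc.2] with ω h
  simp [h]

/-- The expected conditional covariance of the error does not depend on the initial estimate. -/
theorem expectedCov_errorRun [IsProbabilityMeasure μ] (t : ℕ) :
    X.expectedCov (X.errorRun g c t) =
      crossMoment μ (X.errorRun g X.initialMean t) (X.errorRun g X.initialMean t) := by
  ext a b
  rw [expectedCov, Matrix.of_apply, integral_condExp X.arrivals_le, crossMoment_apply]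
  refine integral_congr_ae ?_
  filter_upwards [X.condExp_errorRun g c t a, X.condExp_errorRun g c t b] with ω ha hb
  rw [ha, hb, X.errorRun_eq_add_biasRun g c X.initialMean t ω]
  simp

/-- Covariance matrix of the initial state. -/
noncomputable def initialCov : Matrix (Fin n) (Fin n) ℝ :=
  crossMoment μ (fun ω => X.x0 ω - X.initialMean) (fun ω => X.x0 ω - X.initialMean)

theorem initialCov_nonneg [IsProbabilityMeasure μ] : 0 ≤ X.initialCov :=
  crossMoment_self_nonneg (X.x0_memLp.sub (memLp_const _))

/-- The choice of `c` makes the rank-one term arbitrary; this is how convergence for every initial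
estimate yields stability. -/
theorem crossMoment_initial [IsProbabilityMeasure μ] :
    crossMoment μ (fun ω => X.x0 ω - c) (fun ω => X.x0 ω - c) =
      X.initialCov + vecMulVec (X.initialMean - c) (X.initialMean - c) := by
  set e : Ω → Fin n → ℝ := fun ω => X.x0 ω - X.initialMean
  set h := X.initialMean - c with hh
  have heL : MemLp e 2 μ := X.x0_memLp.sub (memLp_const _)
  have hhL : MemLp (fun _ : Ω => h) 2 μ := memLp_const _
  have hsL : MemLp (fun ω => e ω + h) 2 μ := heL.add hhL
  have hfun : (fun ω => X.x0 ω - c) = fun ω => e ω + h := by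
    funext ω
    simp [e, hh]
  have he0 : ∀ a, ∫ ω, e ω a ∂μ = 0 := fun a => by
    have hint : Integrable (fun ω => X.x0 ω a) μ := (X.x0_memLp.eval a).integrable one_le_two
    exact (integral_sub hint (integrable_const _)).trans (by simp [initialMean])
  have heh : crossMoment μ e (fun _ => h) = 0 := by
    ext a b
    rw [crossMoment_apply, integral_mul_const, he0, zero_mul, Matrix.zero_apply]
  have hhe : crossMoment μ (fun _ => h) e = 0 := by
    rw [← crossMoment_transpose, heh, Matrix.transpose_zero]
  have hhh : crossMoment μ (fun _ => h) (fun _ => h) = vecMulVec h h := by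
    ext a b
    simp [crossMoment_apply, vecMulVec_apply]
  rw [hfun, crossMoment_add_left heL hhL hsL, crossMoment_add_right heL heL hhL,
    crossMoment_add_right hhL heL hhL, heh, hhe, hhh, add_zero, zero_add]
  rfl

end Realization

/-! ### Deterministic covariance recursions -/

variable {n s : ℕ} {m : Fin (s + 1) → ℕ} (N : ProcessingNetwork n s m) (δ : Fin (s + 1) → ℕ)

/-- The covariance recursion with time-varying gains. -/
noncomputable def covRun (g : ℕ → ∀ i, Matrix (Fin n) (Fin (m i)) ℝ)
    (M : Matrix (Fin n) (Fin n) ℝ) : ℕ → Matrix (Fin n) (Fin n) ℝ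
  | 0 => M
  | t + 1 => N.covStep δ Finset.univ (g t) (covRun g M t)

theorem covRun_const (K : ∀ i, Matrix (Fin n) (Fin (m i)) ℝ) (M : Matrix (Fin n) (Fin n) ℝ)
    (t : ℕ) : N.covRun δ (fun _ => K) M t = (N.covStep δ Finset.univ K)^[t] M := by
  induction t with
  | zero => rfl
  | succ t ih => rw [covRun, ih, Function.iterate_succ_apply']

/-- The counterpart of `kfMultiStep` for arbitrary gains. -/
noncomputable def gainMultiStep (G : ConstantGains n s m) (b : ℕ) :
    ℕ → Matrix (Fin n) (Fin n) ℝ → Matrix (Fin n) (Fin n) ℝ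
  | 0, M => M
  | j + 1, M => gainMultiStep G b j
      (N.covStep δ (N.activeSensors δ (b + j)) (G.transient (b + j)) M)

theorem gainMultiStep_continuous (G : ConstantGains n s m) (b j : ℕ) :
    Continuous (N.gainMultiStep δ G b j) := by
  induction j with
  | zero => exact continuous_id
  | succ j ih => exact ih.comp (N.covStep_continuous δ _ _)

variable {δ}

theorem mem_activeSensors {d : ℕ} {i} : i ∈ N.activeSensors δ d ↔ N.totalDelay δ i ≤ d := by
  simp [activeSensors]

theorem activeSensors_maxDelay (hsorted : Monotone (N.totalDelay δ)) :
    N.activeSensors δ (N.maxDelay δ) = Finset.univ :=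
  Finset.eq_univ_of_forall fun i => N.mem_activeSensors.2 (hsorted (Fin.le_last i))

theorem minDelay_le_maxDelay (hsorted : Monotone (N.totalDelay δ)) :
    N.minDelay δ ≤ N.maxDelay δ := hsorted (Fin.zero_le _)

theorem minDelay_pos (hδ : ∀ i, 0 < δ i) : 0 < N.minDelay δ :=
  (hδ 0).trans_le (Nat.le_add_right _ _)

theorem covStep_univ_of_active {I : Finset (Fin (s + 1))}
    {K K' : ∀ i, Matrix (Fin n) (Fin (m i)) ℝ} (h : ∀ i ∈ I, K i = K' i) (h0 : ∀ i ∉ I, K i = 0)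
    (M : Matrix (Fin n) (Fin n) ℝ) : N.covStep δ Finset.univ K M = N.covStep δ I K' M := by
  rw [covStep, covStep, N.josephUpdate_subset δ (Finset.subset_univ I) fun i _ hi => h0 i hi,
    N.josephUpdate_congr δ h]

/-- The covariance recursion of a constant-gain filter: steady iterations, the multi-step update with
fewer and fewer sensors, and the multi-step prediction. -/
theorem covRun_gainSchedule (hδ : ∀ i, 0 < δ i) (hsorted : Monotone (N.totalDelay δ))
    (G : ConstantGains n s m) (M : Matrix (Fin n) (Fin n) ℝ) (j : ℕ) :
    N.covRun δ (N.gainSchedule δ G (j + (N.maxDelay δ - 1 + N.fusionDelay δ))) M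
        (j + (N.maxDelay δ - 1 + N.fusionDelay δ)) =
      N.timeUpdate^[N.predLength δ] (N.gainMultiStep δ G (N.minDelay δ)
        (N.maxDelay δ - N.minDelay δ) ((N.covStep δ Finset.univ G.steady)^[j] M)) := by
  have hmin := N.minDelay_pos hδ
  have hmm := N.minDelay_le_maxDelay hsorted
  have hle : ∀ i, N.totalDelay δ i ≤ N.maxDelay δ := fun i => hsorted (Fin.le_last i)
  have hge : ∀ i, N.minDelay δ ≤ N.totalDelay δ i := fun i => hsorted (Fin.zero_le i)
  set k := j + (N.maxDelay δ - 1 + N.fusionDelay δ) with hk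
  set g := N.gainSchedule δ G k with hg
  -- Data of time `t` have delay at least `maxDelay` exactly when `t < j`, which explains the offset
  -- `maxDelay - 1 + fusionDelay` in `k`.
  have hsteady : ∀ t ≤ j, N.covRun δ g M t = (N.covStep δ Finset.univ G.steady)^[t] M := by
    intro t
    induction t with
    | zero => exact fun _ => rfl
    | succ t ih =>
      intro ht
      have hgt : g t = G.steady := by
        funext i
        have := hle i
        rw [hg, gainSchedule, if_pos (by omega), if_pos (by omega)]
      rw [covRun, ih (by omega), hgt, Function.iterate_succ_apply']
  -- The equation on `t` and `q` says that the next `q` steps use data of delays `minDelay + q - 1`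
  -- down to `minDelay`.
  have htrans : ∀ q t, q ≤ N.maxDelay δ - N.minDelay δ →
      t + N.fusionDelay δ + N.minDelay δ + q = k + 1 →
      N.covRun δ g M (t + q) =
        N.gainMultiStep δ G (N.minDelay δ) q (N.covRun δ g M t) := by
    intro q
    induction q with
    | zero => exact fun t _ _ => rfl
    | succ q ih =>
      intro t hq ht
      have hd : k - N.fusionDelay δ - t = N.minDelay δ + q := by omega
      have hstep : N.covRun δ g M (t + 1) = N.covStep δ (N.activeSensors δ (N.minDelay δ + q))
          (G.transient (N.minDelay δ + q)) (N.covRun δ g M t) := by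
        refine N.covStep_univ_of_active (fun i hi => ?_) (fun i hi => ?_) _
        · rw [mem_activeSensors] at hi
          rw [hg, gainSchedule, if_pos (by omega), if_neg (by omega), hd]
        · rw [mem_activeSensors] at hi
          rw [hg, gainSchedule, if_neg (by omega)]
      rw [gainMultiStep, ← hstep, ← ih (t + 1) (by omega) (by omega)]
      congr 1
      omega
  -- From here on the data are more recent than any sensor can deliver, so all gains are zero. The
  -- additive test in the schedule keeps this correct where the subtraction defining the delay
  -- truncates.
  have hpred : ∀ p t, k + 1 ≤ t + N.fusionDelay δ + N.minDelay δ →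
      N.covRun δ g M (t + p) = N.timeUpdate^[p] (N.covRun δ g M t) := by
    intro p
    induction p with
    | zero => exact fun t _ => rfl
    | succ p ih =>
      intro t ht
      rw [Function.iterate_succ_apply', ← ih t ht]
      have h0 : ∀ i, g (t + p) i = 0 := fun i => by
        have := hge i
        rw [hg, gainSchedule, if_neg (by omega)]
      refine (N.covStep_univ_of_active (I := ∅) (K' := 0) (by simp) (fun i _ => h0 i) _).trans ?_
      simp [covStep, josephUpdate, meanResidual]
  have hsplit : k = j + (N.maxDelay δ - N.minDelay δ) + N.predLength δ := by
    rw [predLength]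
    omega
  conv_lhs => rw [hsplit]
  rw [hpred _ _ (by omega), htrans _ _ le_rfl (by omega), hsteady j le_rfl]

/-- The definition peels off the step performed first, of largest delay; inductions on the lower end
need the step performed last. -/
theorem kfMultiStep_succ (b j : ℕ) (P : Matrix (Fin n) (Fin n) ℝ) :
    N.kfMultiStep δ b (j + 1) P = N.kfStep δ b (N.kfMultiStep δ (b + 1) j P) := by
  induction j generalizing P with
  | zero => rfl
  | succ j ih =>
    have h : b + 1 + j = b + (j + 1) := by omega
    rw [kfMultiStep, ih, kfMultiStep, h]

variable {P : Matrix (Fin n) (Fin n) ℝ}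

theorem le_kfStep (hδ : ∀ i, 0 < δ i) {d d' : ℕ} (hd : d ≤ d') (hP : P.PosDef)
    (hfix : N.kfStep δ d' P = P) {M : Matrix (Fin n) (Fin n) ℝ} (hM : P ≤ M) :
    P ≤ N.kfStep δ d M :=
  calc P = N.kfStep δ d' P := hfix.symm
    _ ≤ N.kfStep δ d P := N.kfStep_anti hδ hd hP
    _ ≤ N.kfStep δ d M := N.kfStep_mono hδ d hP hM

/-- Fewer sensors can only increase the covariance. This keeps the iterates positive definite
without controllability, so that the inverses in the next step are genuine. -/
theorem le_kfMultiStep (hδ : ∀ i, 0 < δ i) {d : ℕ} (hP : P.PosDef)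
    (hfix : N.kfStep δ d P = P) (b j : ℕ) (hbj : b + j ≤ d) : P ≤ N.kfMultiStep δ b j P := by
  induction j generalizing b with
  | zero => exact le_rfl
  | succ j ih =>
    rw [kfMultiStep_succ]
    exact N.le_kfStep hδ (by omega) hP hfix (ih (b + 1) (by omega))

/-- Each transient gain is the Kalman gain of the very covariance reached at its delay, so the
Joseph form equals the Riccati step there. -/
theorem gainMultiStep_kalmanGains (hδ : ∀ i, 0 < δ i) (hP : P.PosDef)
    (hfix : N.kfStep δ (N.maxDelay δ) P = P) (b q : ℕ) (hbq : b + q ≤ N.maxDelay δ) :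
    N.gainMultiStep δ (N.kalmanGains δ P) b q
        (N.kfMultiStep δ (b + q) (N.maxDelay δ - (b + q)) P) =
      N.kfMultiStep δ b (N.maxDelay δ - b) P := by
  induction q with
  | zero => rfl
  | succ q ih =>
    rw [← ih (by omega), gainMultiStep]
    have hr : N.maxDelay δ - (b + q) = N.maxDelay δ - (b + q + 1) + 1 := by omega
    rw [hr, kfMultiStep_succ, ← N.covStep_kalmanGain hδ (b + q)
      (posDef_of_le hP (N.le_kfMultiStep hδ hP hfix (b + q + 1)
        (N.maxDelay δ - (b + q + 1)) (by omega)))]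
    rfl

/-- At each step the Riccati map is below the step with arbitrary gains, and the latter is monotone.
The lower bound `P` only serves to keep the smaller trajectory positive definite. -/
theorem kfMultiStep_le_gainMultiStep (hδ : ∀ i, 0 < δ i) {d : ℕ} (hP : P.PosDef)
    (hfix : N.kfStep δ d P = P) (G : ConstantGains n s m) (b j : ℕ) (hbj : b + j ≤ d)
    {M M' : Matrix (Fin n) (Fin n) ℝ} (hPM : P ≤ M) (hM : M ≤ M') :
    N.kfMultiStep δ b j M ≤ N.gainMultiStep δ G b j M' := by
  induction j generalizing M M' with
  | zero => exact hM
  | succ j ih =>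
    exact ih (by omega) (N.le_kfStep hδ (by omega) hP hfix hPM)
      ((N.kfStep_le_covStep (G.transient (b + j)) hδ (b + j) (posDef_of_le hP hPM)).trans
        (N.covStep_mono δ _ _ hM))

/-! ### The steady state of a constant-gain filter -/

namespace Realization

variable {N} {Ω : Type*} [MeasurableSpace Ω] {μ : Measure Ω} [IsProbabilityMeasure μ]
  (X : Realization N δ μ)

theorem crossMoment_errorRun (hδ : ∀ i, 0 < δ i) (g : ℕ → ∀ i, Matrix (Fin n) (Fin (m i)) ℝ)
    (c : Fin n → ℝ) (t : ℕ) :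
    crossMoment μ (X.errorRun g c t) (X.errorRun g c t) =
      N.covRun δ g (X.initialCov + vecMulVec (X.initialMean - c) (X.initialMean - c)) t := by
  induction t with
  | zero => exact X.crossMoment_initial c
  | succ t ih => rw [X.crossMoment_errorRun_succ g c hδ, ih, covRun]

theorem predictorMSE_eq (hδ : ∀ i, 0 < δ i) (K : ∀ i, Matrix (Fin n) (Fin (m i)) ℝ)
    (c : Fin n → ℝ) (t : ℕ) :
    X.predictorMSE K c t = (N.covStep δ Finset.univ K)^[t]
      (X.initialCov + vecMulVec (X.initialMean - c) (X.initialMean - c)) := by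
  rw [← covRun_const, ← X.crossMoment_errorRun hδ]
  ext a b
  simp only [predictorMSE, Matrix.of_apply, crossMoment_apply, ← X.state_sub_filterRun,
    Pi.sub_apply]

/-- Unlike the mean squared error, this has no rank-one bias term, because conditioning on the
arrivals removes the effect of the initial estimate. -/
theorem errorCov_eq (hδ : ∀ i, 0 < δ i) (G : ConstantGains n s m) (c : Fin n → ℝ) (k : ℕ) :
    X.errorCov G c k = N.covRun δ (N.gainSchedule δ G k) X.initialCov k := by
  have h1 : (fun ω => X.state k ω - X.estimate G c k ω) =
      X.errorRun (N.gainSchedule δ G k) c k := funext fun ω => X.state_sub_filterRun _ c k ω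
  have h2 := X.crossMoment_errorRun hδ (N.gainSchedule δ G k) X.initialMean k
  rw [sub_self, Matrix.zero_vecMulVec, add_zero] at h2
  rw [errorCov, h1, X.expectedCov_errorRun, h2]

variable {X} {K : ∀ i, Matrix (Fin n) (Fin (m i)) ℝ} {S : Matrix (Fin n) (Fin n) ℝ}

theorem HasSteadyState.tendsto_initialCov (hδ : ∀ i, 0 < δ i) (h : X.HasSteadyState K S) :
    Tendsto (fun t => (N.covStep δ Finset.univ K)^[t] X.initialCov) atTop (𝓝 S) := by
  have := h X.initialMean
  simpa only [X.predictorMSE_eq hδ, sub_self, Matrix.zero_vecMulVec, add_zero] using this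

/-- The runs started from the true mean and from the mean minus `x` have the same limit, and their
difference is the propagated `x xᵀ`. -/
theorem HasSteadyState.isStabilizing (hδ : ∀ i, 0 < δ i) (h : X.HasSteadyState K S) :
    N.IsStabilizing Finset.univ K := fun x => by
  have h1 := h (X.initialMean - x)
  simp only [X.predictorMSE_eq hδ, sub_sub_cancel] at h1
  have h2 := h1.sub (h.tendsto_initialCov hδ)
  simpa only [N.covStep_iterate_sub, add_sub_cancel_left, sub_self] using h2

theorem HasSteadyState.tendsto (hδ : ∀ i, 0 < δ i) (h : X.HasSteadyState K S)
    {M : Matrix (Fin n) (Fin n) ℝ} (hM : 0 ≤ M) :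
    Tendsto (fun t => (N.covStep δ Finset.univ K)^[t] M) atTop (𝓝 S) :=
  (h.isStabilizing hδ).tendsto_covStep X.initialCov_nonneg hM (h.tendsto_initialCov hδ)

theorem HasSteadyState.nonneg (hδ : ∀ i, 0 < δ i) (h : X.HasSteadyState K S) : 0 ≤ S := by
  refine nonneg_of_tendsto (h.tendsto_initialCov hδ) fun t => ?_
  induction t with
  | zero => exact X.initialCov_nonneg
  | succ t ih =>
    rw [Function.iterate_succ_apply']
    exact N.covStep_nonneg _ _ hδ ih

theorem HasSteadyState.fixed (hδ : ∀ i, 0 < δ i) (h : X.HasSteadyState K S) :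
    N.covStep δ Finset.univ K S = S :=
  isFixedPt_of_tendsto_iterate (h.tendsto_initialCov hδ) (N.covStep_continuous δ _ _).continuousAt

theorem hasSteadyState_of_isStabilizing (hδ : ∀ i, 0 < δ i)
    (hK : N.IsStabilizing Finset.univ K) (hS : 0 ≤ S) (hfix : N.covStep δ Finset.univ K S = S) :
    X.HasSteadyState K S := fun c => by
  simp only [X.predictorMSE_eq hδ]
  exact hK.tendsto_fixed (add_nonneg X.initialCov_nonneg (vecMulVec_nonneg _)) hS hfix

theorem HasSteadyState.tendsto_errorCov (hδ : ∀ i, 0 < δ i)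
    (hsorted : Monotone (N.totalDelay δ)) {G : ConstantGains n s m}
    (h : X.HasSteadyState G.steady S) (c : Fin n → ℝ) :
    Tendsto (fun k => X.errorCov G c k) atTop
      (𝓝 (N.timeUpdate^[N.predLength δ] (N.gainMultiStep δ G (N.minDelay δ)
        (N.maxDelay δ - N.minDelay δ) S))) := by
  -- After this shift the time index counts the steady steps; the number and form of the later steps
  -- no longer depend on it.
  rw [← tendsto_add_atTop_iff_nat (N.maxDelay δ - 1 + N.fusionDelay δ)]
  simp only [X.errorCov_eq hδ, N.covRun_gainSchedule hδ hsorted]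
  have hc : Continuous fun M => N.timeUpdate^[N.predLength δ] (N.gainMultiStep δ G (N.minDelay δ)
      (N.maxDelay δ - N.minDelay δ) M) :=
    (N.timeUpdate_continuous.iterate _).comp (N.gainMultiStep_continuous δ G _ _)
  exact (hc.tendsto S).comp (h.tendsto_initialCov hδ)

theorem hasSteadyState_kalmanGains (hδ : ∀ i, 0 < δ i) (hsorted : Monotone (N.totalDelay δ))
    (hP : P.PosDef) (hfix : N.kfStep δ (N.maxDelay δ) P = P)
    (hK : N.IsStabilizing (N.activeSensors δ (N.maxDelay δ)) K) :
    X.HasSteadyState (N.kalmanGains δ P).steady P := by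
  have h1 := N.isStabilizing_kalmanGain K hδ hP hfix hK
  have h2 := (N.covStep_kalmanGain hδ (N.maxDelay δ) hP).trans hfix
  rw [N.activeSensors_maxDelay hsorted] at h1 h2
  exact hasSteadyState_of_isStabilizing hδ h1 hP.zero_le h2

/-- The Riccati solution is a subsolution for any steady gains, hence below their steady state; the
transient and prediction steps preserve the inequality. -/
theorem HasSteadyState.predictedCov_le (hδ : ∀ i, 0 < δ i) (hsorted : Monotone (N.totalDelay δ))
    (hP : P.PosDef) (hfix : N.kfStep δ (N.maxDelay δ) P = P) {G : ConstantGains n s m}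
    (h : X.HasSteadyState G.steady S) :
    N.predictedCov δ P ≤ N.timeUpdate^[N.predLength δ] (N.gainMultiStep δ G (N.minDelay δ)
      (N.maxDelay δ - N.minDelay δ) S) := by
  have hmm := N.minDelay_le_maxDelay hsorted
  have hle := N.kfStep_le_covStep G.steady hδ (N.maxDelay δ) hP
  rw [hfix, N.activeSensors_maxDelay hsorted] at hle
  have hPS : P ≤ S := le_of_covStep_tendsto hle le_rfl (h.tendsto hδ hP.zero_le)
  exact N.timeUpdate_mono.iterate _
    (N.kfMultiStep_le_gainMultiStep hδ hP hfix G _ _ (by omega) le_rfl hPS)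

end Realization

end ProcessingNetwork

/-! ### The main theorem -/

theorem theorem2 {n s : ℕ} {m : Fin (s + 1) → ℕ} (N : ProcessingNetwork n s m)
    (δ : Fin (s + 1) → ℕ) (hδ : ∀ i, 0 < δ i) (hsorted : Monotone (N.totalDelay δ))
    {Ω : Type*} [MeasurableSpace Ω] (μ : Measure Ω) [IsProbabilityMeasure μ]
    (X : N.Realization δ μ)
    (hsteady : ∃ K S, X.HasSteadyState K S) :
    (N.IsControllable → ∃ P, N.IsARESolution δ P) ∧
    ∀ P, N.IsARESolution δ P →
      (∀ P', N.IsARESolution δ P' → P' = P) ∧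
      X.HasSteadyState (N.kalmanGains δ P).steady P ∧
      ∀ xh0 : Fin n → ℝ,
        Tendsto (fun k => X.errorCov (N.kalmanGains δ P) xh0 k) atTop (𝓝 (N.predictedCov δ P)) ∧
        Tendsto (fun k => (X.errorCov (N.kalmanGains δ P) xh0 k).trace) atTop
          (𝓝 (N.predictedCov δ P).trace) ∧
        ∀ (G : ConstantGains n s m) (S : Matrix (Fin n) (Fin n) ℝ),
          (∃ S₀, X.HasSteadyState G.steady S₀) →
          Tendsto (fun k => X.errorCov G xh0 k) atTop (𝓝 S) →
          (S - N.predictedCov δ P).PosSemidef := by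
  have hact := N.activeSensors_maxDelay hsorted
  obtain ⟨K, S, hKS⟩ := hsteady
  have hK : N.IsStabilizing (N.activeSensors δ (N.maxDelay δ)) K := by
    rw [hact]
    exact hKS.isStabilizing hδ
  refine ⟨fun hc => ?_, fun P hP => ?_⟩
  · obtain ⟨P, hP, hfix⟩ := hc.exists_fixed hδ (N.maxDelay δ) (K := K) (hKS.nonneg hδ)
      (by rw [hact]; exact hKS.fixed hδ)
    exact ⟨P, hP, hfix.symm⟩
  obtain ⟨hPpos, hfix⟩ := hP
  replace hfix := hfix.symm
  have hsteadyP : X.HasSteadyState (N.kalmanGains δ P).steady P :=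
    ProcessingNetwork.Realization.hasSteadyState_kalmanGains hδ hsorted hPpos hfix hK
  have hmm := N.minDelay_le_maxDelay hsorted
  have hpred : N.timeUpdate^[N.predLength δ] (N.gainMultiStep δ (N.kalmanGains δ P) (N.minDelay δ)
      (N.maxDelay δ - N.minDelay δ) P) = N.predictedCov δ P := by
    have h := N.gainMultiStep_kalmanGains hδ hPpos hfix (N.minDelay δ)
      (N.maxDelay δ - N.minDelay δ) (by omega)
    rw [Nat.add_sub_cancel' hmm, Nat.sub_self] at h
    exact congrArg _ h
  refine ⟨fun P' hP' => N.fixed_unique K hδ hP'.1 hP'.2.symm hPpos hfix hK, hsteadyP,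
    fun xh0 => ?_⟩
  have hlim : Tendsto (fun k => X.errorCov (N.kalmanGains δ P) xh0 k) atTop
      (𝓝 (N.predictedCov δ P)) := by
    rw [← hpred]
    exact hsteadyP.tendsto_errorCov hδ hsorted xh0
  refine ⟨hlim, ?_, fun G S' hG hS' => ?_⟩
  · have hc : Continuous fun M : Matrix (Fin n) (Fin n) ℝ => M.trace := by fun_prop
    exact (hc.tendsto _).comp hlim
  · obtain ⟨S₀, hS₀⟩ := hG
    -- The assumed limit must be the one computed from the steady state of `G`.
    rw [tendsto_nhds_unique hS' (hS₀.tendsto_errorCov hδ hsorted xh0)]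
    exact hS₀.predictedCov_le hδ hsorted hPpos hfix
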